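/- **Theorem.** Let $\Omega=(0,L_1)\times(0,L_2)$ with $L_1,L_2>0$, let $0<\epsilon<1$, $3\le k\le 6$, $N\in\mathbb N$ and $\tau>0$. Let the BDF-$k$ kernels $b^{(k)}_j$ be defined by $\sum_{\ell=1}^{k}\frac1\ell(1-\zeta)^{\ell-1}=\sum_{\ell=0}^{k-1}b^{(k)}_\ell\zeta^\ell$ and $b^{(k)}_j=0$ for $j\ge k$, and put $D_kv^n=\frac1\tau\sum_{j=1}^{n}b^{(k)}_{n-j}(v^j-v^{j-1})$. Consider the BDF-$k$ scheme for the phase field crystal model, with $\Omega$-periodic boundary conditions, $$D_k\phi^n=\Delta\mu^n,\qquad \mu^n=(1+\Delta)^2\phi^n+(\phi^n)^3-\epsilon\phi^n,\qquad k\le n\le N.$$ Assume that $\tau\le\frac{2}{3\epsilon}\,b_0^{(k)}$. Then the scheme is uniquely solvable: 1. at each time level $k\le n\le N$, for all previous values $\phi^0,\dots,\phi^{n-1}\in L^2(\Omega)$ there is exactly one $\phi^n\in L^2(\Omega)$ that satisfies the equation at level $n$; 2. consequently, for all starting values $\phi^0,\dots,\phi^{k-1}\in L^2(\Omega)$ there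 is exactly one sequence $\phi^k,\dots,\phi^N$ in $L^2(\Omega)$ that satisfies the scheme at all levels $k\le n\le N$. Here existence holds in the strong sense: $\Delta\phi^n$, $\Delta^2\phi^n$, $(\phi^n)^3$, $\mu^n$ and $\Delta\mu^n$ are functions in $L^2(\Omega)$, where $w=\Delta v$ means $\int_\Omega v\,\Delta\psi\,dx=\int_\Omega w\,\psi\,dx$ for all smooth $\Omega$-periodic $\psi:\mathbb R^2\to\mathbb R$. Uniqueness holds in the larger class of all $\phi^n\in L^2(\Omega)$ for which $(\phi^n)^3$ is integrable over $\Omega$ and the equation is satisfied in the sense of periodic distributions, that is, $$\int_\Omega (D_k\phi^n)\,\psi\,dx=\int_\Omega\phi^n\,(1+\Delta)^2\Delta\psi\,dx+\int_\Omega\big((\phi^n)^3-\epsilon\phi^n\big)\Delta\psi\,dx$$ for all smooth $\Omega$-periodic $\psi$. -/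

import Mathlib

open MeasureTheory Laplacian
open scoped ContDiff

noncomputable section

namespace PFC

/-- The BDF-`k` kernels `b_j^{(k)}`: the coefficients of the generating polynomial
`∑_{ℓ=1}^{k} (1/ℓ) (1 - ζ)^(ℓ-1)`. They vanish for `j ≥ k`. -/
def bdfKernel (k j : ℕ) : ℝ :=
  (∑ l ∈ Finset.Icc 1 k,
    Polynomial.C ((1 : ℝ) / (l : ℝ)) * (1 - Polynomial.X) ^ (l - 1)).coeff j

/-- The BDF-`k` difference quotient
`D_k v^n = (1/τ) ∑_{j=1}^{n} b_{n-j}^{(k)} (v^j - v^{j-1})` of a sequence in a real vector space. -/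
def bdf {V : Type*} [AddCommGroup V] [Module ℝ V] (k : ℕ) (τ : ℝ) (v : ℕ → V) (n : ℕ) : V :=
  (1 / τ) • ∑ j ∈ Finset.Icc 1 n, bdfKernel k (n - j) • (v j - v (j - 1))

/-- The plane `ℝ²`, with its Euclidean structure. -/
abbrev Plane : Type := EuclideanSpace ℝ (Fin 2)

/-- The period cell `Ω = (0, L 0) × (0, L 1)`. -/
def cell (L : Fin 2 → ℝ) : Set Plane := {x | ∀ i, x i ∈ Set.Ioo 0 (L i)}

/-- The real Hilbert space `L²(Ω)`. Its elements are regarded as `Ω`-periodic functions; the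
periodic boundary conditions enter through the periodic test functions below. -/
abbrev L2 (L : Fin 2 → ℝ) : Type := Lp ℝ 2 (volume.restrict (cell L))

/-- Smooth functions on the plane which are `Ω`-periodic. -/
structure IsTest (L : Fin 2 → ℝ) (ψ : Plane → ℝ) : Prop where
  smooth : ContDiff ℝ ∞ ψ
  periodic : ∀ (i : Fin 2) (x : Plane), ψ (x + EuclideanSpace.single i (L i)) = ψ x

/-- `w = Δ v` in the sense of periodic distributions, both functions being in `L²(Ω)`. -/
def IsLaplacian (L : Fin 2 → ℝ) (v w : L2 L) : Prop :=
  ∀ ψ : Plane → ℝ, IsTest L ψ → ∫ x in cell L, v x * (Δ ψ) x = ∫ x in cell L, w x * ψ x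

/-- `μ = (1 + Δ)² u + u³ - ε u`, all terms being in `L²(Ω)`. -/
def IsChemicalPotential (L : Fin 2 → ℝ) (ε : ℝ) (u μ : L2 L) : Prop :=
  -- `v = (1 + Δ) u`, `w = (1 + Δ) v` and `c = u³`
  ∃ v w c : L2 L, IsLaplacian L u (v - u) ∧ IsLaplacian L v (w - v) ∧
    (∀ᵐ x ∂(volume.restrict (cell L)), c x = u x ^ 3) ∧ μ = w + c - ε • u

/-- The sequence `φ` satisfies the BDF-`k` equation
`D_k φ^n = Δ μ^n`, `μ^n = (1 + Δ)² φ^n + (φ^n)³ - ε φ^n`, with periodic boundary conditions at the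
time level `n`, all the terms being functions in `L²(Ω)`. -/
def SolvesAt (L : Fin 2 → ℝ) (ε : ℝ) (k : ℕ) (τ : ℝ) (φ : ℕ → L2 L) (n : ℕ) : Prop :=
  ∃ μ : L2 L, IsChemicalPotential L ε (φ n) μ ∧ IsLaplacian L μ (bdf k τ φ n)

/-- The sequence `φ` satisfies the same equation at the time level `n` merely in the sense of
periodic distributions: no derivative of `φ^n` needs to be a function, and of `(φ^n)³` only
integrability is asked (so that the equation makes sense). Testing the equations behind `SolvesAt`
with `ψ` and its iterated Laplacians shows that `SolvesAt` implies `SolvesWeaklyAt`. -/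
def SolvesWeaklyAt (L : Fin 2 → ℝ) (ε : ℝ) (k : ℕ) (τ : ℝ) (φ : ℕ → L2 L) (n : ℕ) : Prop :=
  IntegrableOn (fun x => φ n x ^ 3) (cell L) ∧
  ∀ ψ : Plane → ℝ, IsTest L ψ →
    ∫ x in cell L, bdf k τ φ n x * ψ x =
      (∫ x in cell L, φ n x * ((Δ ψ) x + 2 * (Δ (Δ ψ)) x + (Δ (Δ (Δ ψ))) x)) +
      ∫ x in cell L, (φ n x ^ 3 - ε * φ n x) * (Δ ψ) x

end PFC

end

/-!
In an orthonormal basis of `L²(Ω)` of real plane waves `x ↦ cos (ξ · x - π / 4)`, the unknown `z` of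
one time step satisfies `z + S z³ = z₀`, where `S` multiplies the mode with eigenvalue `l` of `-Δ`
by `l / (a + l ((1 - l)² - ε))` with `a = b₀ / τ`. The restriction on the time step makes this
multiplier nonnegative. In dimension two its denominator grows fast enough for the multiplier to be
summable over the modes, so that `S` is trace class and maps `L¹` to bounded functions: every
solution with integrable cube is bounded, and the monotonicity of the cube gives uniqueness.

For existence, replace the cube by a Lipschitz truncation `g`. Writing `z = z₀ + T w` with
`T = √S` turns the equation into `w + T g(z₀ + T w) = 0`, where the left-hand side is Lipschitz and
strongly monotone in `w`. Monotonicity also bounds `w` in terms of `T g(z₀)` alone, hence bounds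
`z` pointwise independently of the truncation, which therefore becomes inactive at a high level.
-/

namespace PFC

section MonotoneOperators

variable {E F : Type*} [NormedAddCommGroup E] [InnerProductSpace ℝ E] [NormedAddCommGroup F]
  [InnerProductSpace ℝ F]

theorem mul_norm_sub_le_of_stronglyMonotone {f : E → E} {m : ℝ} {x y : E}
    (hf : m * ‖x - y‖ ^ 2 ≤ inner ℝ (f x - f y) (x - y)) : m * ‖x - y‖ ≤ ‖f x - f y‖ := by
  rcases (norm_nonneg (x - y)).eq_or_lt with h | h
  · simp [← h]
  · refine le_of_mul_le_mul_right ?_ h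
    calc m * ‖x - y‖ * ‖x - y‖ = m * ‖x - y‖ ^ 2 := by ring
      _ ≤ inner ℝ (f x - f y) (x - y) := hf
      _ ≤ ‖f x - f y‖ * ‖x - y‖ := real_inner_le_norm _ _

/-- `x ↦ x - t • f x` with `t = m / (K² + 1)` is a contraction. -/
theorem exists_eq_zero_of_lipschitz_of_stronglyMonotone [CompleteSpace E] {f : E → E} {K : NNReal}
    (hK : LipschitzWith K f) {m : ℝ} (hm : 0 < m)
    (hf : ∀ x y, m * ‖x - y‖ ^ 2 ≤ inner ℝ (f x - f y) (x - y)) : ∃ x, f x = 0 := by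
  set t : ℝ := m / (K ^ 2 + 1)
  have ht : 0 < t := by positivity
  have htK : t * (K ^ 2 + 1) = m := div_mul_cancel₀ _ (by positivity)
  have hsq (x y : E) : ‖(x - t • f x) - (y - t • f y)‖ ^ 2 ≤ (1 - t * m) * ‖x - y‖ ^ 2 := by
    have hKsq : ‖f x - f y‖ ^ 2 ≤ (K ^ 2 + 1) * ‖x - y‖ ^ 2 := by
      have h := pow_le_pow_left₀ (norm_nonneg _) (hK.norm_sub_le x y) 2
      nlinarith [sq_nonneg ‖x - y‖]
    calc ‖(x - t • f x) - (y - t • f y)‖ ^ 2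
        = ‖x - y‖ ^ 2 - 2 * t * inner ℝ (f x - f y) (x - y) + t ^ 2 * ‖f x - f y‖ ^ 2 := by
          rw [show (x - t • f x) - (y - t • f y) = (x - y) - t • (f x - f y) by
            rw [smul_sub]; abel, norm_sub_sq_real, real_inner_smul_right, real_inner_comm,
            norm_smul, Real.norm_of_nonneg ht.le]
          ring
      _ ≤ ‖x - y‖ ^ 2 - 2 * t * (m * ‖x - y‖ ^ 2) + t ^ 2 * ((K ^ 2 + 1) * ‖x - y‖ ^ 2) := by
          gcongr
          exact hf x y
      _ = (1 - t * m) * ‖x - y‖ ^ 2 := by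
          linear_combination t * ‖x - y‖ ^ 2 * htK
  have hlt : Real.sqrt (1 - t * m) < 1 := by
    rw [Real.sqrt_lt' one_pos]
    nlinarith [mul_pos ht hm]
  have hcontract : ContractingWith (Real.sqrt (1 - t * m)).toNNReal fun x => x - t • f x := by
    refine ⟨Real.toNNReal_lt_one.2 hlt, LipschitzWith.of_dist_le_mul fun x y => ?_⟩
    rw [Real.coe_toNNReal _ (Real.sqrt_nonneg _), dist_eq_norm, dist_eq_norm,
      ← Real.sqrt_sq (norm_nonneg (x - y)), ← Real.sqrt_mul' _ (sq_nonneg _)]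
    exact Real.le_sqrt_of_sq_le (hsq x y)
  have hfix := sub_eq_self.1 hcontract.fixedPoint_isFixedPt
  exact ⟨_, (smul_eq_zero.1 hfix).resolve_left ht.ne'⟩

theorem exists_hammerstein_solution [CompleteSpace E] [CompleteSpace F] (T : E →L[ℝ] F)
    {B : F → F} {K : NNReal} (hK : LipschitzWith K B)
    (hB : ∀ u v, 0 ≤ inner ℝ (B u - B v) (u - v)) (z₀ : F) :
    ∃ w : E, w = -T.adjoint (B (z₀ + T w)) ∧ ‖w‖ ≤ ‖T.adjoint (B z₀)‖ := by
  set f : E → E := fun w => w + T.adjoint (B (z₀ + T w)) with hf_def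
  have hlip : LipschitzWith (1 + ‖T.adjoint‖₊ * (K * (0 + ‖T‖₊))) f :=
    LipschitzWith.id.add
      (T.adjoint.lipschitz.comp (hK.comp ((LipschitzWith.const z₀).add T.lipschitz)))
  have hmono (w v : E) : 1 * ‖w - v‖ ^ 2 ≤ inner ℝ (f w - f v) (w - v) := by
    have h := hB (z₀ + T w) (z₀ + T v)
    rw [add_sub_add_left_eq_sub, ← map_sub, ← T.adjoint_inner_left, map_sub] at h
    rw [hf_def, add_sub_add_comm, inner_add_left, real_inner_self_eq_norm_sq]
    linarith
  obtain ⟨w, hw⟩ := exists_eq_zero_of_lipschitz_of_stronglyMonotone hlip one_pos hmono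
  refine ⟨w, eq_neg_of_add_eq_zero_left hw, ?_⟩
  have hle := mul_norm_sub_le_of_stronglyMonotone (hmono w 0)
  rw [hw] at hle
  simpa [hf_def] using hle

end MonotoneOperators

section DiagonalOperators

variable {ι H : Type*} [NormedAddCommGroup H] [InnerProductSpace ℝ H]

theorem eq_of_forall_inner_basis_eq (b : HilbertBasis ι ℝ H) {x y : H}
    (h : ∀ i, inner ℝ (b i) x = inner ℝ (b i) y) : x = y :=
  b.repr.injective <| by
    ext i
    rw [b.repr_apply_apply, b.repr_apply_apply, h i]

theorem exists_forall_inner_basis_eq_mul (b : HilbertBasis ι ℝ H) {t : ι → ℝ} {C : ℝ}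
    (ht : ∀ i, |t i| ≤ C) (x : H) : ∃ y : H, ∀ i, inner ℝ (b i) y = t i * inner ℝ (b i) x := by
  have hmem : Memℓp (fun i => t i * b.repr x i) 2 :=
    Memℓp.mono (g := fun i => C * ‖b.repr x i‖) ((lp.memℓp (b.repr x)).norm.const_mul C) fun i => by
      rw [norm_mul]
      exact mul_le_mul_of_nonneg_right (ht i) (norm_nonneg _)
  refine ⟨b.repr.symm ⟨_, hmem⟩, fun i => ?_⟩
  rw [← b.repr_apply_apply, ← b.repr_apply_apply, LinearIsometryEquiv.apply_symm_apply]

theorem exists_isSelfAdjoint_forall_inner_basis_eq_mul [CompleteSpace H] (b : HilbertBasis ι ℝ H)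
    {t : ι → ℝ} {C : ℝ} (ht : ∀ i, |t i| ≤ C) :
    ∃ T : H →L[ℝ] H, IsSelfAdjoint T ∧ ∀ x i, inner ℝ (b i) (T x) = t i * inner ℝ (b i) x := by
  choose T hT using exists_forall_inner_basis_eq_mul b ht
  let T' : H →ₗ[ℝ] H :=
    { toFun := T
      map_add' := fun x y => eq_of_forall_inner_basis_eq b fun i => by
        simp only [hT, inner_add_right, mul_add]
      map_smul' := fun r x => eq_of_forall_inner_basis_eq b fun i => by
        simp only [hT, real_inner_smul_right, RingHom.id_apply, mul_left_comm] }
  have hsymm : T'.IsSymmetric := fun x y => by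
    rw [← b.tsum_inner_mul_inner, ← b.tsum_inner_mul_inner]
    refine tsum_congr fun i => ?_
    change inner ℝ (T x) (b i) * _ = _ * inner ℝ (b i) (T y)
    rw [real_inner_comm, hT, hT, real_inner_comm x]
    ring
  exact ⟨⟨T', hsymm.continuous⟩, ContinuousLinearMap.isSelfAdjoint_iff_isSymmetric.2 hsymm, hT⟩

theorem hasSum_inner_basis_sq (b : HilbertBasis ι ℝ H) (x : H) :
    HasSum (fun i => inner ℝ (b i) x ^ 2) (‖x‖ ^ 2) := by
  refine (real_inner_self_eq_norm_sq x ▸ b.hasSum_inner_mul_inner x x).congr_fun fun i => ?_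
  rw [real_inner_comm, sq]

theorem norm_sq_le_mul_of_inner_basis_sq_le (b : HilbertBasis ι ℝ H) {x y : H} {C : ℝ}
    (h : ∀ i, inner ℝ (b i) y ^ 2 ≤ C * inner ℝ (b i) x ^ 2) : ‖y‖ ^ 2 ≤ C * ‖x‖ ^ 2 :=
  hasSum_le h (hasSum_inner_basis_sq b y) ((hasSum_inner_basis_sq b x).mul_left C)

/-- With `S = T²`, one solves `w + T (B (z₀ + T w)) = 0` and puts `z = z₀ + T w`; the coefficients
of `T w` are absolutely summable because `T` is a Hilbert–Schmidt operator. -/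
theorem exists_diagonal_hammerstein_solution [CompleteSpace H] (b : HilbertBasis ι ℝ H)
    {s : ι → ℝ} (hs0 : ∀ i, 0 ≤ s i) (hs : Summable s) {B : H → H} {K : NNReal}
    (hK : LipschitzWith K B) (hB : ∀ u v, 0 ≤ inner ℝ (B u - B v) (u - v)) {z₀ : H}
    (hz₀ : Summable fun i => |inner ℝ (b i) z₀|) :
    ∃ z : H, (∀ i, inner ℝ (b i) z = inner ℝ (b i) z₀ - s i * inner ℝ (b i) (B z)) ∧
      (Summable fun i => |inner ℝ (b i) z|) ∧
      ∑' i, |inner ℝ (b i) z| ≤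
        ∑' i, |inner ℝ (b i) z₀| + (∑' i, s i + (∑' i, s i) * ‖B z₀‖ ^ 2) := by
  have hsle (i : ι) : s i ≤ ∑' i, s i := hs.le_tsum i fun j _ => hs0 j
  obtain ⟨T, hTsa, hT⟩ := exists_isSelfAdjoint_forall_inner_basis_eq_mul b
    (t := fun i => √(s i)) fun i => (abs_of_nonneg (s i).sqrt_nonneg).trans_le
      (Real.sqrt_le_sqrt (hsle i))
  obtain ⟨w, hw, hwle⟩ := exists_hammerstein_solution T hK hB z₀
  rw [hTsa.adjoint_eq] at hw hwle
  have hwsq : ‖w‖ ^ 2 ≤ (∑' i, s i) * ‖B z₀‖ ^ 2 := by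
    refine (pow_le_pow_left₀ (norm_nonneg w) hwle 2).trans
      (norm_sq_le_mul_of_inner_basis_sq_le b fun i => ?_)
    rw [hT, mul_pow, Real.sq_sqrt (hs0 i)]
    exact mul_le_mul_of_nonneg_right (hsle i) (sq_nonneg _)
  have hle (i : ι) : |inner ℝ (b i) (z₀ + T w)| ≤
      |inner ℝ (b i) z₀| + (s i + inner ℝ (b i) w ^ 2) := by
    rw [inner_add_right, hT]
    refine (abs_add_le _ _).trans (add_le_add_right ?_ _)
    rw [abs_le]
    constructor <;> nlinarith [Real.sq_sqrt (hs0 i), sq_nonneg (√(s i) + inner ℝ (b i) w),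
      sq_nonneg (√(s i) - inner ℝ (b i) w)]
  have hsum := hz₀.hasSum.add (hs.hasSum.add (hasSum_inner_basis_sq b w))
  have hzsum := hsum.summable.of_nonneg_of_le (fun i => abs_nonneg _) hle
  refine ⟨z₀ + T w, fun i => ?_, hzsum, (hasSum_le hle hzsum.hasSum hsum).trans (by gcongr)⟩
  rw [inner_add_right, hT]
  nth_rewrite 1 [hw]
  rw [inner_neg_right, hT, ← mul_neg, ← mul_assoc, ← neg_mul_eq_mul_neg, Real.mul_self_sqrt (hs0 i),
    sub_eq_add_neg]

end DiagonalOperators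

section HammersteinEquation

open Set

variable {α ι : Type*} [MeasurableSpace α] {μ : Measure α}

theorem inner_toLp_eq_integral (u : Lp ℝ 2 μ) {f : α → ℝ} (hf : MemLp f 2 μ) :
    inner ℝ u (hf.toLp f) = ∫ x, f x * u x ∂μ := by
  rw [L2.inner_def]
  refine integral_congr_ae ?_
  filter_upwards [hf.coeFn_toLp] with x hx
  simp [hx]

theorem inner_sub_nonneg_of_monotone {g : ℝ → ℝ} (hg : Monotone g) {u v c d : Lp ℝ 2 μ}
    (hc : c =ᵐ[μ] g ∘ u) (hd : d =ᵐ[μ] g ∘ v) : 0 ≤ inner ℝ (c - d) (u - v) := by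
  rw [L2.inner_def]
  refine integral_nonneg_of_ae ?_
  filter_upwards [hc, hd, Lp.coeFn_sub c d, Lp.coeFn_sub u v] with x hcx hdx hcd huv
  rw [hcd, huv, Pi.sub_apply, Pi.sub_apply, hcx, hdx]
  exact (mul_comm _ _).trans_ge ((monovary_id_iff.2 hg).sub_mul_sub_nonneg (v x) (u x))

variable [IsFiniteMeasure μ]

theorem memLp_comp_of_ae_abs_le {g : ℝ → ℝ} (hg : Continuous g) {z : α → ℝ}
    (hz : AEStronglyMeasurable z μ) {K : ℝ} (hK : ∀ᵐ x ∂μ, |z x| ≤ K) (p : ENNReal) :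
    MemLp (g ∘ z) p μ := by
  obtain ⟨C, hC⟩ := (isCompact_Icc (a := -K) (b := K)).exists_bound_of_continuousOn hg.continuousOn
  refine MemLp.of_bound (hg.comp_aestronglyMeasurable hz) C ?_
  filter_upwards [hK] with x hx
  exact hC _ (abs_le.1 hx)

variable {b : HilbertBasis ι ℝ (Lp ℝ 2 μ)} {C : ℝ}

/-- The partial sums are dominated in the Banach lattice `L²`, whose order is closed. -/
theorem ae_abs_le_tsum_abs_inner_mul (hb : ∀ i, ∀ᵐ x ∂μ, |b i x| ≤ C) {z : Lp ℝ 2 μ}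
    (hz : Summable fun i => |inner ℝ (b i) z|) :
    ∀ᵐ x ∂μ, |z x| ≤ (∑' i, |inner ℝ (b i) z|) * C := by
  have hexpand : HasSum (fun i => inner ℝ (b i) z • b i) z := by
    simpa only [b.repr_apply_apply] using b.hasSum_repr z
  have hbound := hz.hasSum.smul_const (Lp.const 2 μ C)
  have hle (i : ι) : |inner ℝ (b i) z • b i| ≤ |inner ℝ (b i) z| • Lp.const 2 μ C := by
    rw [← Lp.coeFn_le]
    filter_upwards [hb i, Lp.coeFn_abs (inner ℝ (b i) z • b i), Lp.coeFn_const 2 μ C,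
      Lp.coeFn_smul (inner ℝ (b i) z) (b i),
      Lp.coeFn_smul |inner ℝ (b i) z| (Lp.const 2 μ C)] with x hbx habs hconst hsmul hsmul'
    rw [habs, hsmul, hsmul', Pi.smul_apply, Pi.smul_apply, hconst, smul_eq_mul, abs_mul]
    exact mul_le_mul_of_nonneg_left hbx (abs_nonneg _)
  have hsum : |z| ≤ (∑' i, |inner ℝ (b i) z|) • Lp.const 2 μ C :=
    abs_le'.2 ⟨hasSum_le (fun i => (le_abs_self _).trans (hle i)) hexpand hbound,
      hasSum_le (fun i => (neg_le_abs _).trans (hle i)) hexpand.neg hbound⟩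
  rw [← Lp.coeFn_le] at hsum
  filter_upwards [hsum, Lp.coeFn_abs z, Lp.coeFn_const 2 μ C,
    Lp.coeFn_smul (∑' i, |inner ℝ (b i) z|) (Lp.const 2 μ C)] with x hx habs hconst hsmul
  rwa [habs, hsmul, Pi.smul_apply, hconst] at hx

/-- `z` solves the Hammerstein equation `z + S (g ∘ z) = z₀`, where `S` is the operator with
eigenvalues `s i` in the basis `b`. The equation is stated coefficientwise, so that it makes sense
as soon as `g ∘ z` is integrable and the basis functions are bounded. -/
structure IsHammersteinSolution (b : HilbertBasis ι ℝ (Lp ℝ 2 μ)) (s : ι → ℝ) (g : ℝ → ℝ)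
    (z₀ z : Lp ℝ 2 μ) : Prop where
  integrable : Integrable (fun x => g (z x)) μ
  inner_eq (i : ι) :
    inner ℝ (b i) z = inner ℝ (b i) z₀ - s i * ∫ x, g (z x) * b i x ∂μ

variable {s : ι → ℝ} {g : ℝ → ℝ} {z₀ z z' : Lp ℝ 2 μ}

/-- `S` maps `L¹` to functions with absolutely summable coefficients. -/
theorem IsHammersteinSolution.exists_ae_abs_le (hz : IsHammersteinSolution b s g z₀ z)
    (hb : ∀ i, ∀ᵐ x ∂μ, |b i x| ≤ C) (hs0 : ∀ i, 0 ≤ s i) (hs : Summable s)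
    (hz₀ : Summable fun i => |inner ℝ (b i) z₀|) : ∃ K, ∀ᵐ x ∂μ, |z x| ≤ K := by
  have hcoeff (i : ι) : |∫ x, g (z x) * b i x ∂μ| ≤ ∫ x, |g (z x)| * C ∂μ := by
    refine norm_integral_le_of_norm_le (f := fun x => g (z x) * b i x)
      (hz.integrable.abs.mul_const C) ?_
    filter_upwards [hb i] with x hx
    rw [norm_mul]
    exact mul_le_mul_of_nonneg_left hx (abs_nonneg _)
  refine ⟨_, ae_abs_le_tsum_abs_inner_mul hb ?_⟩
  refine (hz₀.add (hs.mul_right (∫ x, |g (z x)| * C ∂μ))).of_nonneg_of_le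
    (fun i => abs_nonneg _) fun i => ?_
  rw [hz.inner_eq i]
  refine (abs_sub _ _).trans ?_
  rw [abs_mul, abs_of_nonneg (hs0 i)]
  gcongr
  exacts [hs0 i, hcoeff i]

/-- For the difference `d` of two solutions and the difference `e` of their nonlinear terms,
`d = -S e`. Hence `0 ≤ ⟪e, d⟫ = -⟪e, S e⟫ ≤ 0`, which forces `S e = 0`. -/
theorem IsHammersteinSolution.eq (hz : IsHammersteinSolution b s g z₀ z)
    (hz' : IsHammersteinSolution b s g z₀ z')
    (hb : ∀ i, ∀ᵐ x ∂μ, |b i x| ≤ C) (hs0 : ∀ i, 0 ≤ s i) (hs : Summable s)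
    (hg : Monotone g) (hgc : Continuous g) (hz₀ : Summable fun i => |inner ℝ (b i) z₀|) :
    z = z' := by
  obtain ⟨K, hK⟩ := hz.exists_ae_abs_le hb hs0 hs hz₀
  obtain ⟨K', hK'⟩ := hz'.exists_ae_abs_le hb hs0 hs hz₀
  have hmem := memLp_comp_of_ae_abs_le hgc (Lp.aestronglyMeasurable z) hK 2
  have hmem' := memLp_comp_of_ae_abs_le hgc (Lp.aestronglyMeasurable z') hK' 2
  set e := hmem.toLp _ - hmem'.toLp _ with he
  have hd (i : ι) : inner ℝ (b i) (z - z') = -(s i * inner ℝ (b i) e) := by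
    rw [he, inner_sub_right, inner_sub_right, inner_toLp_eq_integral, inner_toLp_eq_integral,
      hz.inner_eq, hz'.inner_eq]
    simp only [Function.comp_apply]
    ring
  have hmono : 0 ≤ inner ℝ e (z - z') :=
    inner_sub_nonneg_of_monotone hg hmem.coeFn_toLp hmem'.coeFn_toLp
  have hnonneg (i : ι) : 0 ≤ s i * inner ℝ (b i) e ^ 2 := mul_nonneg (hs0 i) (sq_nonneg _)
  have hsum : HasSum (fun i => s i * inner ℝ (b i) e ^ 2) (-inner ℝ e (z - z')) := by
    refine (b.hasSum_inner_mul_inner e (z - z')).neg.congr_fun fun i => ?_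
    rw [hd, real_inner_comm]
    ring
  have hzero : (fun i => s i * inner ℝ (b i) e ^ 2) = 0 :=
    (hasSum_zero_iff_of_nonneg hnonneg).1
      (le_antisymm (neg_nonpos.2 hmono) (hsum.nonneg hnonneg) ▸ hsum)
  refine eq_of_forall_inner_basis_eq b fun i => sub_eq_zero.1 ?_
  rw [← inner_sub_right, hd, neg_eq_zero]
  simpa using congrFun hzero i

theorem exists_lipschitzWith_monotone_eqOn_Icc (hg : Monotone g) (hgl : LocallyLipschitz g)
    {R : ℝ} (hR : 0 ≤ R) :
    ∃ K f, LipschitzWith K f ∧ Monotone f ∧ EqOn f g (Icc (-R) R) := by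
  obtain ⟨K, hK⟩ := LocallyLipschitzOn.exists_lipschitzOnWith_of_compact
    (isCompact_Icc (a := -R) (b := R)) hgl.locallyLipschitzOn
  have hle : -R ≤ R := by linarith
  refine ⟨K * 1, IccExtend hle ((Icc (-R) R).domRestrict g),
    (lipschitzOnWith_iff_restrict.1 hK).comp (LipschitzWith.projIcc hle),
    Monotone.IccExtend hle fun x y h => hg h, fun x hx => IccExtend_of_mem hle _ hx⟩

/-- Solve with `g` truncated at a height `R`; the resulting bound on the solution depends only on
the values of `g` along `z₀`, so that a large enough `R` makes the truncation invisible. -/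
theorem exists_isHammersteinSolution (hb : ∀ i, ∀ᵐ x ∂μ, |b i x| ≤ C) (hC : 0 ≤ C)
    (hs0 : ∀ i, 0 ≤ s i) (hs : Summable s) (hg : Monotone g) (hgl : LocallyLipschitz g)
    (hg0 : g 0 = 0) (hz₀ : Summable fun i => |inner ℝ (b i) z₀|) :
    ∃ z, IsHammersteinSolution b s g z₀ z ∧ MemLp (g ∘ z) 2 μ := by
  have hz₀C := ae_abs_le_tsum_abs_inner_mul hb hz₀
  have hmem₀ := memLp_comp_of_ae_abs_le hgl.continuous (Lp.aestronglyMeasurable z₀) hz₀C 2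
  set R : ℝ := (∑' i, |inner ℝ (b i) z₀| +
    (∑' i, s i + (∑' i, s i) * ‖hmem₀.toLp _‖ ^ 2)) * C
  have hS : 0 ≤ ∑' i, s i := tsum_nonneg hs0
  have hle : (∑' i, |inner ℝ (b i) z₀|) * C ≤ R :=
    mul_le_mul_of_nonneg_right (le_add_of_nonneg_right (by positivity)) hC
  have hR0 : 0 ≤ R := (mul_nonneg (tsum_nonneg fun i => abs_nonneg _) hC).trans hle
  obtain ⟨K, f, hfK, hf, hfg⟩ := exists_lipschitzWith_monotone_eqOn_Icc hg hgl hR0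
  have hf0 : f 0 = 0 := (hfg ⟨neg_nonpos.2 hR0, hR0⟩).trans hg0
  have hcoe (u : Lp ℝ 2 μ) : hfK.compLp hf0 u =ᵐ[μ] f ∘ u := hfK.coeFn_compLp hf0 u
  have heq (u : Lp ℝ 2 μ) (hu : ∀ᵐ x ∂μ, |u x| ≤ R) : hfK.compLp hf0 u =ᵐ[μ] g ∘ u := by
    filter_upwards [hcoe u, hu] with x hx hux
    rw [hx, Function.comp_apply, hfg (abs_le.1 hux), Function.comp_apply]
  have hBz₀ : hfK.compLp hf0 z₀ = hmem₀.toLp _ :=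
    Lp.ext ((heq z₀ (hz₀C.mono fun x hx => hx.trans hle)).trans hmem₀.coeFn_toLp.symm)
  obtain ⟨z, hz, hzsum, hzle⟩ := exists_diagonal_hammerstein_solution b hs0 hs
    (hfK.lipschitzWith_compLp hf0)
    (fun u v => inner_sub_nonneg_of_monotone hf (hcoe u) (hcoe v)) hz₀
  rw [hBz₀] at hzle
  have hzR : ∀ᵐ x ∂μ, |z x| ≤ R := (ae_abs_le_tsum_abs_inner_mul hb hzsum).mono fun x hx =>
    hx.trans (mul_le_mul_of_nonneg_right hzle hC)
  have hmem : MemLp (g ∘ z) 2 μ := (memLp_congr_ae (heq z hzR)).1 (Lp.memLp _)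
  have hBz : hfK.compLp hf0 z = hmem.toLp _ := Lp.ext ((heq z hzR).trans hmem.coeFn_toLp.symm)
  refine ⟨z, ⟨hmem.integrable one_le_two, fun i => ?_⟩, hmem⟩
  rw [hz i, hBz, inner_toLp_eq_integral]
  rfl

end HammersteinEquation

section Cell

variable {L : Fin 2 → ℝ}

theorem isOpen_cell (L : Fin 2 → ℝ) : IsOpen (cell L) := by
  have hcell : cell L = ⋂ i, {x : Plane | x i ∈ Set.Ioo 0 (L i)} := by ext; simp [cell]
  rw [hcell]
  exact isOpen_iInter_of_finite fun i => isOpen_Ioo.preimage (by fun_prop)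

theorem cell_subset_image_Icc (L : Fin 2 → ℝ) :
    cell L ⊆ (WithLp.toLp 2 : (Fin 2 → ℝ) → Plane) '' Set.Icc 0 L := fun x hx =>
  ⟨WithLp.ofLp x, ⟨fun i => (hx i).1.le, fun i => (hx i).2.le⟩, rfl⟩

theorem isCompact_image_Icc (L : Fin 2 → ℝ) :
    IsCompact ((WithLp.toLp 2 : (Fin 2 → ℝ) → Plane) '' Set.Icc 0 L) :=
  isCompact_Icc.image (PiLp.continuous_toLp 2 _)

theorem volume_cell_lt_top (L : Fin 2 → ℝ) : volume (cell L) < ⊤ :=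
  (measure_mono (cell_subset_image_Icc L)).trans_lt (isCompact_image_Icc L).measure_lt_top

instance isFiniteMeasure_restrict_cell (L : Fin 2 → ℝ) :
    IsFiniteMeasure ((volume : Measure Plane).restrict (cell L)) :=
  isFiniteMeasure_restrict.2 (volume_cell_lt_top L).ne

theorem volume_real_cell_pos (hL : ∀ i, 0 < L i) : 0 < (volume : Measure Plane).real (cell L) := by
  refine ENNReal.toReal_pos ((isOpen_cell L).measure_pos volume ?_).ne' (volume_cell_lt_top L).ne
  exact ⟨WithLp.toLp 2 fun i => L i / 2, fun i => ⟨half_pos (hL i), half_lt_self (hL i)⟩⟩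

theorem setIntegral_cell_eq (L : Fin 2 → ℝ) (g : Plane → ℝ) :
    ∫ x in cell L, g x = ∫ y in Set.Icc 0 L, g (WithLp.toLp 2 y) := by
  have hpre : (WithLp.toLp 2 : (Fin 2 → ℝ) → Plane) ⁻¹' cell L =
      Set.pi Set.univ fun i => Set.Ioo 0 (L i) := by
    ext x
    simp [cell]
  rw [← (PiLp.volume_preserving_toLp (Fin 2)).setIntegral_preimage_emb
    (MeasurableEquiv.toLp 2 (Fin 2 → ℝ)).measurableEmbedding, hpre]
  exact setIntegral_congr_set Measure.univ_pi_Ioo_ae_eq_Icc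

theorem memLp_cell_of_continuous {g : Plane → ℝ} (hg : Continuous g) (p : ENNReal) :
    MemLp g p (volume.restrict (cell L)) := by
  obtain ⟨C, hC⟩ := (isCompact_image_Icc L).exists_bound_of_continuousOn hg.continuousOn
  refine MemLp.of_bound hg.aestronglyMeasurable C ?_
  exact (ae_restrict_mem (isOpen_cell L).measurableSet).mono fun x hx =>
    hC x (cell_subset_image_Icc L hx)

theorem integrableOn_cell_of_continuous {g : Plane → ℝ} (hg : Continuous g) :
    IntegrableOn g (cell L) :=
  memLp_one_iff_integrable.1 (memLp_cell_of_continuous hg 1)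

end Cell

section PeriodicCalculus

variable {L : Fin 2 → ℝ} {f g : Plane → ℝ}

theorem laplacian_eq_sum_fderiv_fderiv {ι E : Type*} [Fintype ι] [NormedAddCommGroup E]
    [InnerProductSpace ℝ E] [FiniteDimensional ℝ E] (e : OrthonormalBasis ι ℝ E) {f : E → ℝ}
    (hf : ContDiff ℝ 2 f) (x : E) :
    (Δ f) x = ∑ i, fderiv ℝ (fun y => fderiv ℝ f y (e i)) x (e i) := by
  have hdiff : DifferentiableAt ℝ (fderiv ℝ f) x :=
    (hf.fderiv_right (m := 1) (by norm_num)).differentiable one_ne_zero x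
  rw [InnerProductSpace.laplacian_eq_iteratedFDeriv_orthonormalBasis f e]
  refine Finset.sum_congr rfl fun i _ => ?_
  rw [iteratedFDeriv_two_apply, fderiv_clm_apply hdiff (differentiableAt_const _)]
  simp

theorem IsTest.mul (hf : IsTest L f) (hg : IsTest L g) : IsTest L fun x => f x * g x where
  smooth := hf.smooth.mul hg.smooth
  periodic i x := by rw [hf.periodic, hg.periodic]

theorem IsTest.differentiable (hf : IsTest L f) : Differentiable ℝ f :=
  hf.smooth.differentiable (by simp)

theorem IsTest.fderiv_apply (hf : IsTest L f) (v : Plane) :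
    IsTest L fun x => fderiv ℝ f x v where
  smooth := (hf.smooth.fderiv_right (m := ∞) le_rfl).clm_apply contDiff_const
  periodic i x := by
    rw [← fderiv_comp_add_right, funext (hf.periodic i)]

theorem IsTest.laplacian_eq_sum (hf : IsTest L f) (x : Plane) :
    (Δ f) x = ∑ i, fderiv ℝ (fun y => fderiv ℝ f y (EuclideanSpace.basisFun (Fin 2) ℝ i)) x
      (EuclideanSpace.basisFun (Fin 2) ℝ i) :=
  laplacian_eq_sum_fderiv_fderiv _ (contDiff_infty.1 hf.smooth 2) x

theorem IsTest.laplacian (hf : IsTest L f) : IsTest L (Δ f) := by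
  rw [funext hf.laplacian_eq_sum]
  exact
    { smooth := ContDiff.sum fun i _ => ((hf.fderiv_apply _).fderiv_apply _).smooth
      periodic := fun i x =>
        Finset.sum_congr rfl fun j _ => ((hf.fderiv_apply _).fderiv_apply _).periodic i x }

theorem IsTest.integral_fderiv_apply (hf : IsTest L f) (hL : ∀ i, 0 < L i) (v : Plane) :
    ∫ x in cell L, fderiv ℝ f x v = 0 := by
  set T : (Fin 2 → ℝ) ≃L[ℝ] Plane := (EuclideanSpace.equiv (Fin 2) ℝ).symm with hT
  have hdiv (y : Fin 2 → ℝ) :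
      ∑ j, (v j • (fderiv ℝ f (T y)).comp (T : (Fin 2 → ℝ) →L[ℝ] Plane)) (Pi.single j 1) =
        fderiv ℝ f (T y) v := by
    conv_rhs => rw [← (EuclideanSpace.basisFun (Fin 2) ℝ).sum_repr v, map_sum]
    simp [hT]
  have hdivergence := integral_divergence_of_hasFDerivAt_off_countable' 0 L (fun i => (hL i).le)
    (fun j y => v j * f (T y))
    (fun j y => v j • (fderiv ℝ f (T y)).comp (T : (Fin 2 → ℝ) →L[ℝ] Plane))
    ∅ Set.countable_empty
    (fun j => (continuous_const.mul (hf.smooth.continuous.comp T.continuous)).continuousOn)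
    (fun y _ j => ((hf.differentiable (T y)).hasFDerivAt.comp y T.hasFDerivAt).const_mul _)
  simp only [hdiv] at hdivergence
  rw [setIntegral_cell_eq]
  refine (hdivergence (((hf.fderiv_apply v).smooth.continuous.comp
    T.continuous).continuousOn.integrableOn_compact isCompact_Icc)).trans
    (Finset.sum_eq_zero fun j _ => sub_eq_zero.2 ?_)
  refine setIntegral_congr_fun measurableSet_Icc fun y _ => ?_
  have hface : T (j.insertNth (L j) y) =
      T (j.insertNth ((0 : Fin 2 → ℝ) j) y) + EuclideanSpace.single j (L j) := by
    ext m
    rcases Fin.eq_self_or_eq_succAbove j m with rfl | ⟨m', rfl⟩ <;> simp [hT]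
  simp only [hface, hf.periodic j]

theorem IsTest.integral_fderiv_mul (hf : IsTest L f) (hg : IsTest L g) (hL : ∀ i, 0 < L i)
    (v : Plane) :
    ∫ x in cell L, fderiv ℝ f x v * g x = -∫ x in cell L, f x * fderiv ℝ g x v := by
  have hmul := (hf.mul hg).integral_fderiv_apply hL v
  have hfderiv (x : Plane) : fderiv ℝ (fun y => f y * g y) x v =
      f x * fderiv ℝ g x v + fderiv ℝ f x v * g x := by
    rw [fderiv_fun_mul (hf.differentiable x) (hg.differentiable x)]
    simp [mul_comm]
  simp only [hfderiv] at hmul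
  rw [integral_add (integrableOn_cell_of_continuous (hf.mul (hg.fderiv_apply v)).smooth.continuous)
    (integrableOn_cell_of_continuous ((hf.fderiv_apply v).mul hg).smooth.continuous)] at hmul
  exact eq_neg_of_add_eq_zero_right hmul

theorem IsTest.integral_laplacian_mul (hf : IsTest L f) (hg : IsTest L g) (hL : ∀ i, 0 < L i) :
    ∫ x in cell L, (Δ f) x * g x =
      -∑ i, ∫ x in cell L, fderiv ℝ f x (EuclideanSpace.basisFun (Fin 2) ℝ i) *
        fderiv ℝ g x (EuclideanSpace.basisFun (Fin 2) ℝ i) := by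
  simp only [hf.laplacian_eq_sum, Finset.sum_mul]
  rw [integral_finsetSum _ fun i _ => integrableOn_cell_of_continuous
    (((hf.fderiv_apply _).fderiv_apply _).mul hg).smooth.continuous, ← Finset.sum_neg_distrib]
  exact Finset.sum_congr rfl fun i _ => (hf.fderiv_apply _).integral_fderiv_mul hg hL _

theorem IsTest.integral_laplacian_mul_comm (hf : IsTest L f) (hg : IsTest L g)
    (hL : ∀ i, 0 < L i) :
    ∫ x in cell L, (Δ f) x * g x = ∫ x in cell L, f x * (Δ g) x := by
  simp only [mul_comm (f _), hf.integral_laplacian_mul hg hL, hg.integral_laplacian_mul hf hL,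
    mul_comm (fderiv ℝ g _ _)]

end PeriodicCalculus

section PlaneWaves

variable {E : Type*} [NormedAddCommGroup E] [InnerProductSpace ℝ E]

/-- The real plane wave with wave vector `ξ` and phase `c`. -/
noncomputable def planeWave (ξ : E) (c : ℝ) (x : E) : ℝ :=
  Real.cos (inner ℝ ξ x + c)

theorem contDiff_planeWave (ξ : E) (c : ℝ) {n : WithTop ℕ∞} : ContDiff ℝ n (planeWave ξ c) :=
  Real.contDiff_cos.comp ((contDiff_const.inner ℝ contDiff_id).add contDiff_const)

theorem abs_planeWave_le_one (ξ : E) (c : ℝ) (x : E) : |planeWave ξ c x| ≤ 1 :=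
  Real.abs_cos_le_one _

theorem planeWave_zero_left (c : ℝ) (x : E) : planeWave 0 c x = Real.cos c := by
  simp [planeWave]

theorem planeWave_neg_left (ξ : E) (c : ℝ) (x : E) : planeWave (-ξ) c x = planeWave ξ (-c) x := by
  rw [planeWave, planeWave, ← Real.cos_neg, inner_neg_left, neg_add, neg_neg]

theorem planeWave_mul_planeWave (ξ η : E) (c d : ℝ) (x : E) :
    planeWave ξ c x * planeWave η d x =
      (planeWave (ξ - η) (c - d) x + planeWave (ξ + η) (c + d) x) / 2 := by
  simp only [planeWave, inner_sub_left, inner_add_left]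
  rw [← add_sub_add_comm, add_add_add_comm, Real.cos_sub, Real.cos_add (inner ℝ ξ x + c)]
  ring

theorem fderiv_planeWave_apply (ξ : E) (c : ℝ) (x v : E) :
    fderiv ℝ (planeWave ξ c) x v = inner ℝ ξ v * planeWave ξ (c + Real.pi / 2) x := by
  have hphase : HasFDerivAt (fun y : E => inner ℝ ξ y + c) (innerSL ℝ ξ) x :=
    (innerSL ℝ ξ).hasFDerivAt.add_const c
  have hcos : HasFDerivAt (planeWave ξ c) _ x := hphase.cos
  rw [hcos.fderiv, planeWave, ← add_assoc, Real.cos_add_pi_div_two]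
  simp [mul_comm]

theorem laplacian_planeWave [FiniteDimensional ℝ E] (ξ : E) (c : ℝ) (x : E) :
    (Δ (planeWave ξ c)) x = -‖ξ‖ ^ 2 * planeWave ξ c x := by
  set e := stdOrthonormalBasis ℝ E
  have hdd (v : E) : fderiv ℝ (fun y => fderiv ℝ (planeWave ξ c) y v) x v =
      -(inner ℝ ξ v ^ 2 * planeWave ξ c x) := by
    have hphase : planeWave ξ (c + Real.pi / 2 + Real.pi / 2) x = -planeWave ξ c x := by
      rw [planeWave, planeWave, ← Real.cos_add_pi]
      ring_nf
    simp only [fderiv_planeWave_apply]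
    rw [fderiv_const_mul ((contDiff_planeWave ξ _).differentiable one_ne_zero x)]
    simp only [smul_apply, fderiv_planeWave_apply, hphase, smul_eq_mul]
    ring
  rw [laplacian_eq_sum_fderiv_fderiv e (contDiff_planeWave ξ c)]
  simp only [hdd]
  rw [Finset.sum_neg_distrib, ← Finset.sum_mul, e.sum_sq_inner_left, neg_mul]

end PlaneWaves

section DualLattice

variable {L : Fin 2 → ℝ}

/-- The wave vectors `(2π m₀ / L 0, 2π m₁ / L 1)` of the `Ω`-periodic plane waves. -/
noncomputable def waveVector (L : Fin 2 → ℝ) : (Fin 2 → ℤ) →+ Plane where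
  toFun m := WithLp.toLp 2 fun i => 2 * Real.pi * m i / L i
  map_zero' := by ext; simp
  map_add' m n := by ext; simp [mul_add, add_div]

theorem waveVector_apply (L : Fin 2 → ℝ) (m : Fin 2 → ℤ) (i : Fin 2) :
    waveVector L m i = 2 * Real.pi * m i / L i := rfl

theorem waveVector_eq_zero_iff (hL : ∀ i, 0 < L i) {m : Fin 2 → ℤ} :
    waveVector L m = 0 ↔ m = 0 := by
  refine ⟨fun h => funext fun i => ?_, fun h => h ▸ map_zero _⟩
  have hi : 2 * Real.pi * m i / L i = 0 := congrArg (fun ξ : Plane => ξ i) h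
  simpa [Real.pi_ne_zero, (hL i).ne'] using hi

theorem isTest_planeWave (hL : ∀ i, 0 < L i) (m : Fin 2 → ℤ) (c : ℝ) :
    IsTest L (planeWave (waveVector L m) c) where
  smooth := contDiff_planeWave _ _
  periodic i x := by
    have hturn : inner ℝ (waveVector L m) (EuclideanSpace.single i (L i)) =
        m i * (2 * Real.pi) := by
      rw [EuclideanSpace.inner_single_right, waveVector_apply, conj_trivial,
        mul_div_cancel₀ _ (hL i).ne', mul_comm]
    rw [planeWave, planeWave, inner_add_right, hturn, add_right_comm,
      Real.cos_add_int_mul_two_pi]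

theorem integral_planeWave (hL : ∀ i, 0 < L i) {m : Fin 2 → ℤ} (hm : m ≠ 0) (c : ℝ) :
    ∫ x in cell L, planeWave (waveVector L m) c x = 0 := by
  have hderiv := (isTest_planeWave hL m (c - Real.pi / 2)).integral_fderiv_apply hL
    (waveVector L m)
  simp only [fderiv_planeWave_apply, sub_add_cancel] at hderiv
  rw [integral_const_mul, real_inner_self_eq_norm_sq] at hderiv
  exact (mul_eq_zero.1 hderiv).resolve_left
    (pow_ne_zero 2 (norm_ne_zero_iff.2 ((waveVector_eq_zero_iff hL).not.2 hm)))

theorem integrable_planeWave_mul (m : Fin 2 → ℤ) (c : ℝ) (f : L2 L) :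
    IntegrableOn (fun x => planeWave (waveVector L m) c x * f x) (cell L) :=
  (memLp_cell_of_continuous (contDiff_planeWave _ _ (n := 0)).continuous 2).integrable_mul
    (Lp.memLp f)

end DualLattice

section Torus

variable {L : Fin 2 → ℝ}

noncomputable local instance : MeasureSpace UnitAddCircle := ⟨AddCircle.haarAddCircle⟩

local instance : Measure.IsAddHaarMeasure (volume : Measure UnitAddCircle) :=
  inferInstanceAs (Measure.IsAddHaarMeasure AddCircle.haarAddCircle)

local instance : IsProbabilityMeasure (volume : Measure UnitAddCircle) :=
  inferInstanceAs (IsProbabilityMeasure AddCircle.haarAddCircle)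

/-- The section of the covering map `x ↦ (x i / L i) mod 1` from the plane onto the unit torus
that takes its values in the half-open period cell `∏ (0, L i]`. -/
noncomputable def torusSection (L : Fin 2 → ℝ) (t : UnitAddTorus (Fin 2)) : Plane :=
  WithLp.toLp 2 fun i => (UnitAddTorus.measurableEquivPiIoc 0 t).1 i * L i

theorem coe_torusSection_div (hL : ∀ i, 0 < L i) (t : UnitAddTorus (Fin 2)) (i : Fin 2) :
    ((torusSection L t i / L i : ℝ) : UnitAddCircle) = t i := by
  rw [torusSection, PiLp.toLp_apply, mul_div_cancel_right₀ _ (hL i).ne',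
    UnitAddTorus.coe_measurableEquivPiIoc_apply]
  exact AddCircle.coe_equivIoc

/-- The dilation of the unit cell onto the period cell. -/
noncomputable def cellScaling (hL : ∀ i, 0 < L i) : (Fin 2 → ℝ) ≃L[ℝ] Plane :=
  (ContinuousLinearEquiv.piCongrRight fun i => ContinuousLinearEquiv.unitsEquivAut ℝ
    (Units.mk0 (L i) (hL i).ne')).trans (EuclideanSpace.equiv (Fin 2) ℝ).symm

theorem cellScaling_apply (hL : ∀ i, 0 < L i) (y : Fin 2 → ℝ) (i : Fin 2) :
    cellScaling hL y i = y i * L i := rfl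

theorem exists_measurePreserving_cellScaling (hL : ∀ i, 0 < L i) :
    ∃ c : ENNReal, c ≠ 0 ∧ c ≠ ⊤ ∧ MeasurePreserving (cellScaling hL) volume (c • volume) := by
  have := (cellScaling hL).isAddHaarMeasure_map volume
  refine ⟨Measure.addHaarScalarFactor (Measure.map (cellScaling hL) volume) volume, ?_,
    ENNReal.coe_ne_top, (cellScaling hL).continuous.measurable,
    Measure.isAddLeftInvariant_eq_smul _ _⟩
  exact ENNReal.coe_ne_zero.2 (Measure.addHaarScalarFactor_pos_of_isAddHaarMeasure _ _).ne'

theorem preimage_cellScaling_cell_ae_eq (hL : ∀ i, 0 < L i) :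
    cellScaling hL ⁻¹' cell L =ᵐ[volume] Set.univ.pi fun _ : Fin 2 => Set.Ioc (0 : ℝ) 1 := by
  have hpre : cellScaling hL ⁻¹' cell L = Set.univ.pi fun _ : Fin 2 => Set.Ioo (0 : ℝ) 1 := by
    ext y
    simp only [cell, Set.mem_preimage, Set.mem_ofPred_eq, cellScaling_apply, Set.mem_Ioo,
      Set.mem_univ_pi, mul_pos_iff_of_pos_right (hL _), mul_lt_iff_lt_one_left (hL _)]
  rw [hpre]
  exact Measure.univ_pi_Ioo_ae_eq_Icc.trans Measure.univ_pi_Ioc_ae_eq_Icc.symm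

theorem exists_measurePreserving_torusSection (hL : ∀ i, 0 < L i) :
    ∃ c : ENNReal, c ≠ 0 ∧ c ≠ ⊤ ∧
      MeasurePreserving (torusSection L) volume (c • volume.restrict (cell L)) := by
  obtain ⟨c, hc0, hct, hc⟩ := exists_measurePreserving_cellScaling hL
  refine ⟨c, hc0, hct, ?_⟩
  have hbox : {x : Fin 2 → ℝ | ∀ i, x i ∈ Set.Ioc ((0 : Fin 2 → ℝ) i) ((0 : Fin 2 → ℝ) i + 1)} =
      Set.univ.pi fun _ : Fin 2 => Set.Ioc (0 : ℝ) 1 := by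
    ext
    simp
  have hscaling := hc.restrict_preimage (isOpen_cell L).measurableSet
  rw [Measure.restrict_congr_set (preimage_cellScaling_cell_ae_eq hL), Measure.restrict_smul,
    ← hbox] at hscaling
  have hmeas : MeasurableSet {x : Fin 2 → ℝ |
      ∀ i, x i ∈ Set.Ioc ((0 : Fin 2 → ℝ) i) ((0 : Fin 2 → ℝ) i + 1)} := by
    rw [hbox]
    exact MeasurableSet.univ_pi fun _ => measurableSet_Ioc
  exact hscaling.comp ((measurePreserving_subtype_coe hmeas).comp
    (UnitAddTorus.measurePreserving_equivPiIoc 0))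

theorem mFourier_coe_div (L : Fin 2 → ℝ) (m : Fin 2 → ℤ) (x : Plane) :
    UnitAddTorus.mFourier m (fun i => ((x i / L i : ℝ) : UnitAddCircle)) =
      planeWave (waveVector L m) 0 x -
        planeWave (waveVector L m) (Real.pi / 2) x * Complex.I := by
  have hexp : UnitAddTorus.mFourier m (fun i => ((x i / L i : ℝ) : UnitAddCircle)) =
      Complex.exp ((inner ℝ (waveVector L m) x : ℝ) * Complex.I) := by
    simp only [UnitAddTorus.mFourier, ContinuousMap.coe_mk, fourier_coe_apply, Fin.prod_univ_two,
      PiLp.inner_apply, waveVector_apply, Fin.sum_univ_two, ← Complex.exp_add, RCLike.inner_apply,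
      conj_trivial]
    congr 1
    push_cast
    ring
  rw [hexp, Complex.exp_mul_I, planeWave, planeWave, Real.cos_add_pi_div_two, add_zero]
  push_cast
  ring

theorem mFourierCoeff_comp_torusSection_eq_zero (hL : ∀ i, 0 < L i) (f : L2 L)
    (hf : ∀ m c, ∫ x in cell L, planeWave (waveVector L m) c x * f x = 0) (m : Fin 2 → ℤ) :
    UnitAddTorus.mFourierCoeff (fun t => (f (torusSection L t) : ℂ)) m = 0 := by
  obtain ⟨c, -, hct, hσ⟩ := exists_measurePreserving_torusSection hL
  set wave : ℝ → Plane → ℂ := fun d x => (planeWave (waveVector L (-m)) d x * f x : ℝ)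
  have hint (d : ℝ) : Integrable (wave d) (volume.restrict (cell L)) :=
    (integrable_planeWave_mul _ _ f).ofReal
  have hwave (d : ℝ) : ∫ x in cell L, wave d x = 0 := by
    rw [integral_complex_ofReal, hf, Complex.ofReal_zero]
  have hσ_wave (t : UnitAddTorus (Fin 2)) :
      UnitAddTorus.mFourier (-m) t • (f (torusSection L t) : ℂ) =
        wave 0 (torusSection L t) - wave (Real.pi / 2) (torusSection L t) * Complex.I := by
    have hmFourier := mFourier_coe_div L (-m) (torusSection L t)
    rw [funext (coe_torusSection_div hL t)] at hmFourier
    simp only [hmFourier, wave, smul_eq_mul]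
    push_cast
    ring
  have hsub : Integrable (fun x => wave 0 x - wave (Real.pi / 2) x * Complex.I)
      (volume.restrict (cell L)) := (hint _).sub ((hint _).mul_const _)
  calc UnitAddTorus.mFourierCoeff (fun t => (f (torusSection L t) : ℂ)) m
      = ∫ t, wave 0 (torusSection L t) - wave (Real.pi / 2) (torusSection L t) * Complex.I := by
        simp only [UnitAddTorus.mFourierCoeff, hσ_wave]
    _ = ∫ x, wave 0 x - wave (Real.pi / 2) x * Complex.I ∂(c • volume.restrict (cell L)) := by
        rw [← hσ.map_eq, integral_map hσ.measurable.aemeasurable]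
        rw [hσ.map_eq]
        exact (hsub.smul_measure hct).aestronglyMeasurable
    _ = 0 := by
        rw [integral_smul_measure, integral_sub (hint _) ((hint _).mul_const _),
          integral_mul_const, hwave, hwave, zero_mul, sub_zero, smul_zero]

theorem ae_eq_zero_of_mFourierCoeff_eq_zero {ι : Type*} [Fintype ι] {g : UnitAddTorus ι → ℂ}
    (hg : MemLp g 2) (hcoeff : ∀ n, UnitAddTorus.mFourierCoeff g n = 0) : g =ᵐ[volume] 0 := by
  have hzero : hg.toLp g = 0 := by
    refine UnitAddTorus.mFourierBasis.repr.injective ?_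
    ext n
    rw [UnitAddTorus.mFourierBasis_repr, map_zero]
    refine Eq.trans (integral_congr_ae ?_) (hcoeff n)
    filter_upwards [hg.coeFn_toLp] with t ht
    rw [ht]
  exact hg.coeFn_toLp.symm.trans (Lp.eq_zero_iff_ae_eq_zero.1 hzero)

theorem eq_zero_of_integral_planeWave_mul_eq_zero (hL : ∀ i, 0 < L i) (f : L2 L)
    (hf : ∀ m c, ∫ x in cell L, planeWave (waveVector L m) c x * f x = 0) : f = 0 := by
  obtain ⟨c, hc0, hct, hσ⟩ := exists_measurePreserving_torusSection hL
  have hmem : MemLp (fun x => (f x : ℂ)) 2 (c • volume.restrict (cell L)) :=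
    (Lp.memLp f).ofReal.smul_measure hct
  have hcomp := ae_eq_zero_of_mFourierCoeff_eq_zero (hmem.comp_measurePreserving hσ)
    (mFourierCoeff_comp_torusSection_eq_zero hL f hf)
  have hae : (fun x => (f x : ℂ)) =ᵐ[c • volume.restrict (cell L)] 0 := by
    rw [← eLpNorm_eq_zero_iff hmem.aestronglyMeasurable two_ne_zero,
      ← eLpNorm_comp_measurePreserving hmem.aestronglyMeasurable hσ]
    exact eLpNorm_eq_zero_of_ae_zero hcomp
  refine Lp.eq_zero_iff_ae_eq_zero.2 ?_
  filter_upwards [(Measure.ae_ennreal_smul_measure_iff hc0).1 hae] with x hx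
  exact Complex.ofReal_eq_zero.1 hx

end Torus

section Modes

variable {L : Fin 2 → ℝ}

/-- The eigenvalues of `-Δ` with `Ω`-periodic boundary conditions. -/
noncomputable def eigenvalue (L : Fin 2 → ℝ) (m : Fin 2 → ℤ) : ℝ := ‖waveVector L m‖ ^ 2

theorem eigenvalue_nonneg (L : Fin 2 → ℝ) (m : Fin 2 → ℤ) : 0 ≤ eigenvalue L m := sq_nonneg _

/-- The real plane waves `√(2/|Ω|) cos (ξ · x - π/4) = |Ω|^(-1/2) (cos (ξ · x) + sin (ξ · x))`.
With this phase the waves of wave vectors `ξ` and `-ξ` are orthogonal, so that one family indexed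
by the whole dual lattice replaces the cosines and the sines. -/
noncomputable def mode (L : Fin 2 → ℝ) (m : Fin 2 → ℤ) : Plane → ℝ :=
  √(2 / (volume : Measure Plane).real (cell L)) • planeWave (waveVector L m) (-(Real.pi / 4))

theorem mode_apply (L : Fin 2 → ℝ) (m : Fin 2 → ℤ) (x : Plane) :
    mode L m x = √(2 / (volume : Measure Plane).real (cell L)) *
      planeWave (waveVector L m) (-(Real.pi / 4)) x := rfl

theorem isTest_mode (hL : ∀ i, 0 < L i) (m : Fin 2 → ℤ) : IsTest L (mode L m) where
  smooth := contDiff_const.smul (contDiff_planeWave _ _)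
  periodic i x := by rw [mode_apply, mode_apply, (isTest_planeWave hL m _).periodic]

theorem laplacian_mode (L : Fin 2 → ℝ) (m : Fin 2 → ℤ) :
    Δ (mode L m) = fun x => -eigenvalue L m * mode L m x := by
  ext x
  rw [mode, InnerProductSpace.laplacian_smul _ (contDiff_planeWave _ _).contDiffAt,
    laplacian_planeWave, Pi.smul_apply, eigenvalue, smul_eq_mul, smul_eq_mul, mul_left_comm]

theorem abs_mode_le (L : Fin 2 → ℝ) (m : Fin 2 → ℤ) (x : Plane) :
    |mode L m x| ≤ √(2 / (volume : Measure Plane).real (cell L)) := by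
  rw [mode_apply, abs_mul, abs_of_nonneg (Real.sqrt_nonneg _)]
  exact mul_le_of_le_one_right (Real.sqrt_nonneg _) (abs_planeWave_le_one _ _ x)

theorem mode_mul_mode (L : Fin 2 → ℝ) (m n : Fin 2 → ℤ) (x : Plane) :
    mode L m x * mode L n x = ((volume : Measure Plane).real (cell L))⁻¹ *
      (planeWave (waveVector L (m - n)) 0 x +
        planeWave (waveVector L (m + n)) (-(Real.pi / 2)) x) := by
  have hsqrt := Real.mul_self_sqrt
    (div_nonneg zero_le_two (measureReal_nonneg (μ := (volume : Measure Plane)) (s := cell L)))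
  rw [mode_apply, mode_apply, mul_mul_mul_comm, hsqrt, planeWave_mul_planeWave, map_sub, map_add]
  ring_nf

theorem integral_mode_mul_mode (hL : ∀ i, 0 < L i) (m n : Fin 2 → ℤ) :
    ∫ x in cell L, mode L m x * mode L n x = if m = n then 1 else 0 := by
  have hint (j : Fin 2 → ℤ) (c : ℝ) : IntegrableOn (planeWave (waveVector L j) c) (cell L) :=
    integrableOn_cell_of_continuous (contDiff_planeWave _ _ (n := 0)).continuous
  have hsum : ∫ x in cell L, planeWave (waveVector L (m + n)) (-(Real.pi / 2)) x = 0 := by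
    by_cases hmn : m + n = 0
    · simp [hmn, planeWave_zero_left]
    · exact integral_planeWave hL hmn _
  simp only [mode_mul_mode]
  rw [integral_const_mul, integral_add (hint _ _) (hint _ _), hsum, add_zero]
  split_ifs with hmn
  · simp [hmn, planeWave_zero_left, (volume_real_cell_pos hL).ne']
  · rw [integral_planeWave hL (sub_ne_zero.2 hmn), mul_zero]

theorem memLp_mode (L : Fin 2 → ℝ) (m : Fin 2 → ℤ) :
    MemLp (mode L m) 2 (volume.restrict (cell L)) :=
  memLp_cell_of_continuous ((contDiff_planeWave _ _ (n := 0)).continuous.const_smul _) 2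

theorem orthonormal_mode (hL : ∀ i, 0 < L i) :
    Orthonormal ℝ fun m => (memLp_mode L m).toLp (mode L m) := by
  rw [orthonormal_iff_ite]
  intro m n
  rw [inner_toLp_eq_integral, ← integral_mode_mul_mode hL]
  refine integral_congr_ae ?_
  filter_upwards [(memLp_mode L m).coeFn_toLp] with x hx
  rw [hx, mul_comm]

theorem planeWave_eq_add (ξ : Plane) (c : ℝ) (x : Plane) :
    planeWave ξ c x = Real.sin (Real.pi / 4 - c) * planeWave ξ (-(Real.pi / 4)) x +
      Real.sin (Real.pi / 4 + c) * planeWave (-ξ) (-(Real.pi / 4)) x := by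
  have hsqrt : √2 * √2 = 2 := Real.mul_self_sqrt zero_le_two
  rw [planeWave_neg_left, neg_neg]
  simp only [planeWave, Real.cos_add, Real.sin_add, Real.sin_sub, Real.cos_neg, Real.sin_neg,
    Real.cos_pi_div_four, Real.sin_pi_div_four]
  linear_combination (-(Real.cos (inner ℝ ξ x) * Real.cos c -
    Real.sin (inner ℝ ξ x) * Real.sin c) / 2) * hsqrt

theorem orthogonal_span_mode_eq_bot (hL : ∀ i, 0 < L i) :
    (Submodule.span ℝ (Set.range fun m => (memLp_mode L m).toLp (mode L m)))ᗮ = ⊥ := by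
  refine (Submodule.eq_bot_iff _).2 fun f hf => ?_
  have hmode (m : Fin 2 → ℤ) :
      ∫ x in cell L, planeWave (waveVector L m) (-(Real.pi / 4)) x * f x = 0 := by
    have horth := (Submodule.mem_orthogonal' _ _).1 hf _ (Submodule.subset_span ⟨m, rfl⟩)
    simp only [inner_toLp_eq_integral, mode_apply, mul_assoc] at horth
    rw [integral_const_mul] at horth
    exact (mul_eq_zero.1 horth).resolve_left
      (Real.sqrt_pos.2 (div_pos two_pos (volume_real_cell_pos hL))).ne'
  refine eq_zero_of_integral_planeWave_mul_eq_zero hL f fun m c => ?_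
  simp only [planeWave_eq_add (waveVector L m) c, ← map_neg, add_mul, mul_assoc]
  rw [integral_add ((integrable_planeWave_mul _ _ f).const_mul _)
    ((integrable_planeWave_mul _ _ f).const_mul _), integral_const_mul, integral_const_mul,
    hmode, hmode, mul_zero, mul_zero, add_zero]

/-- The Hilbert basis of `L²(Ω)` that consists of the functions `mode`. -/
noncomputable def modeBasis (hL : ∀ i, 0 < L i) : HilbertBasis (Fin 2 → ℤ) ℝ (L2 L) :=
  HilbertBasis.mkOfOrthogonalEqBot (orthonormal_mode hL) (orthogonal_span_mode_eq_bot hL)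

theorem modeBasis_apply (hL : ∀ i, 0 < L i) (m : Fin 2 → ℤ) :
    modeBasis hL m = (memLp_mode L m).toLp (mode L m) := by
  rw [modeBasis, HilbertBasis.coe_mkOfOrthogonalEqBot]

theorem coeFn_modeBasis (hL : ∀ i, 0 < L i) (m : Fin 2 → ℤ) :
    modeBasis hL m =ᵐ[volume.restrict (cell L)] mode L m := by
  rw [modeBasis_apply]
  exact (memLp_mode L m).coeFn_toLp

theorem ae_abs_modeBasis_le (hL : ∀ i, 0 < L i) (m : Fin 2 → ℤ) :
    ∀ᵐ x ∂volume.restrict (cell L),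
      |modeBasis hL m x| ≤ √(2 / (volume : Measure Plane).real (cell L)) :=
  (coeFn_modeBasis hL m).mono fun x hx => hx ▸ abs_mode_le L m x

theorem integral_mul_modeBasis (hL : ∀ i, 0 < L i) (f : Plane → ℝ) (m : Fin 2 → ℤ) :
    ∫ x in cell L, f x * modeBasis hL m x = ∫ x in cell L, f x * mode L m x :=
  integral_congr_ae ((coeFn_modeBasis hL m).mono fun x hx => congrArg (f x * ·) hx)

theorem inner_modeBasis (hL : ∀ i, 0 < L i) (m : Fin 2 → ℤ) (f : L2 L) :
    inner ℝ (modeBasis hL m) f = ∫ x in cell L, f x * mode L m x := by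
  rw [real_inner_comm, modeBasis_apply, inner_toLp_eq_integral]
  simp only [mul_comm]

theorem isLaplacian_of_inner (hL : ∀ i, 0 < L i) {v w : L2 L}
    (h : ∀ m, inner ℝ (modeBasis hL m) w = -eigenvalue L m * inner ℝ (modeBasis hL m) v) :
    IsLaplacian L v w := by
  intro ψ hψ
  have hmem {g : Plane → ℝ} (hg : IsTest L g) : MemLp g 2 (volume.restrict (cell L)) :=
    memLp_cell_of_continuous hg.smooth.continuous 2
  have hparseval {g : Plane → ℝ} (hg : IsTest L g) (u : L2 L) :
      ∫ x in cell L, u x * g x =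
        ∑' m, inner ℝ (modeBasis hL m) u * ∫ x in cell L, g x * mode L m x := by
    simp only [mul_comm (u _)]
    rw [← inner_toLp_eq_integral u (hmem hg), ← (modeBasis hL).tsum_inner_mul_inner]
    refine tsum_congr fun m => ?_
    rw [inner_toLp_eq_integral, integral_mul_modeBasis, real_inner_comm]
  rw [hparseval hψ.laplacian, hparseval hψ]
  refine tsum_congr fun m => ?_
  rw [hψ.integral_laplacian_mul_comm (isTest_mode hL m) hL, h, laplacian_mode]
  simp only [mul_left_comm (ψ _)]
  rw [integral_const_mul]
  ring

end Modes

section Eigenvalues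

variable {L : Fin 2 → ℝ}

theorem norm_le_mul_norm_waveVector (hL : ∀ i, 0 < L i) (m : Fin 2 → ℤ) :
    ‖m‖ ≤ ‖L‖ / (2 * Real.pi) * ‖waveVector L m‖ := by
  refine (pi_norm_le_iff_of_nonneg (by positivity)).2 fun i => ?_
  have hcoord : (m i : ℝ) = L i / (2 * Real.pi) * waveVector L m i := by
    have := (hL i).ne'
    rw [waveVector_apply]
    field_simp
  rw [Int.norm_eq_abs, hcoord, abs_mul, abs_div, abs_of_pos Real.two_pi_pos]
  gcongr
  · exact norm_le_pi_norm L i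
  · exact PiLp.norm_apply_le (waveVector L m) i

theorem tendsto_eigenvalue_cofinite (hL : ∀ i, 0 < L i) :
    Filter.Tendsto (eigenvalue L) Filter.cofinite Filter.atTop := by
  have hL0 : 0 < ‖L‖ := norm_pos_iff.2 fun h => (hL 0).ne' (congrFun h 0)
  have hnorm : Filter.Tendsto (fun m : Fin 2 → ℤ => ‖m‖) Filter.cofinite Filter.atTop := by
    rw [← Filter.cocompact_eq_cofinite]
    exact tendsto_norm_cocompact_atTop
  exact (Filter.tendsto_pow_atTop two_ne_zero).comp
    ((Filter.tendsto_const_mul_atTop_of_pos (by positivity)).1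
      (Filter.tendsto_atTop_mono (norm_le_mul_norm_waveVector hL) hnorm))

theorem summable_inv_one_add_eigenvalue_sq (hL : ∀ i, 0 < L i) :
    Summable fun m => ((1 + eigenvalue L m) ^ 2)⁻¹ := by
  have hsummable : Summable fun m : Fin 2 → ℤ => ‖m‖ ^ (-4 : ℝ) :=
    EisensteinSeries.summable_one_div_norm_rpow (by norm_num)
  refine summable_of_isBigO hsummable (.of_bound ((‖L‖ / (2 * Real.pi)) ^ 4) ?_)
  filter_upwards [(Set.finite_singleton (0 : Fin 2 → ℤ)).eventually_cofinite_notMem] with m hm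
  have hm0 : 0 < ‖m‖ := norm_pos_iff.2 hm
  have hpow : ‖m‖ ^ 4 ≤ (‖L‖ / (2 * Real.pi)) ^ 4 * (1 + eigenvalue L m) ^ 2 :=
    calc ‖m‖ ^ 4 ≤ (‖L‖ / (2 * Real.pi) * ‖waveVector L m‖) ^ 4 := by
          gcongr
          exact norm_le_mul_norm_waveVector hL m
      _ = (‖L‖ / (2 * Real.pi)) ^ 4 * eigenvalue L m ^ 2 := by rw [eigenvalue]; ring
      _ ≤ _ := by
          have := eigenvalue_nonneg L m
          gcongr
          linarith
  have hone : 0 < (1 + eigenvalue L m) ^ 2 := by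
    have := eigenvalue_nonneg L m
    positivity
  rw [Real.norm_of_nonneg (inv_nonneg.2 hone.le), Real.norm_of_nonneg (by positivity),
    Real.rpow_neg hm0.le, ← div_eq_mul_inv, inv_eq_one_div, div_le_div_iff₀ hone (by positivity),
    one_mul]
  exact_mod_cast hpow

end Eigenvalues

section Symbol

variable {L : Fin 2 → ℝ} {a ε : ℝ}

/-- The symbol of the linear operator `a - Δ ((1 + Δ)² - ε)` as a function of the eigenvalue
`l` of `-Δ`. -/
noncomputable def symbol (a ε l : ℝ) : ℝ := a + l * ((1 - l) ^ 2 - ε)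

theorem symbol_pos {l : ℝ} (hε0 : 0 < ε) (hε1 : ε < 1) (ha : 3 / 2 * ε ≤ a) (hl : 0 ≤ l) :
    0 < symbol a ε l := by
  have hscaled : ε * (l * (1 - l) ^ 2) ≤ l * (1 - l) ^ 2 :=
    mul_le_of_le_one_left (by positivity) hε1.le
  have hcubic : 0 < 3 / 2 + l * (1 - l) ^ 2 - l := by
    nlinarith [mul_nonneg hl (sq_nonneg (l - 4 / 3)), sq_nonneg (l - 4 / 3)]
  rw [symbol]
  nlinarith [mul_pos hε0 hcubic]

theorem mode_equation_iff {l : ℝ} (h : symbol a ε l ≠ 0) (z q c : ℝ) :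
    a * z + q = -l * ((1 - l) ^ 2 * z + c - ε * z) ↔
      z = -(symbol a ε l)⁻¹ * q - l / symbol a ε l * c := by
  have hsolve : -(symbol a ε l)⁻¹ * q - l / symbol a ε l * c = -(q + l * c) / symbol a ε l := by
    ring
  rw [hsolve, eq_div_iff h, symbol]
  constructor <;> intro heq <;> linear_combination heq

theorem isBigO_one_add_pow_symbol (a ε : ℝ) :
    (fun l : ℝ => (1 + l) ^ 3) =O[Filter.atTop] symbol a ε := by
  have hdegree : ((1 + Polynomial.X) ^ 3 : Polynomial ℝ).degree ≤
      (Polynomial.C a + Polynomial.X * ((1 - Polynomial.X) ^ 2 - Polynomial.C ε)).degree := by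
    have hexpand : Polynomial.C a + Polynomial.X * ((1 - Polynomial.X) ^ 2 - Polynomial.C ε) =
        Polynomial.X ^ 3 - 2 * Polynomial.X ^ 2 + (1 - Polynomial.C ε) * Polynomial.X +
          Polynomial.C a := by ring
    rw [hexpand]
    trans 3
    · compute_degree
    · refine ge_of_eq ?_
      compute_degree!
  refine (Polynomial.isBigO_atTop_of_degree_le _ _ hdegree).congr (fun l => ?_) fun l => ?_
  · simp
  · simp [symbol]

theorem exists_one_add_eigenvalue_pow_le_mul_symbol (hL : ∀ i, 0 < L i)
    (hpos : ∀ m, 0 < symbol a ε (eigenvalue L m)) :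
    ∃ C, ∀ m, (1 + eigenvalue L m) ^ 3 ≤ C * symbol a ε (eigenvalue L m) := by
  obtain ⟨C, hC⟩ := (Asymptotics.isBigO_cofinite_iff fun m hm => absurd hm (hpos m).ne').1
    ((isBigO_one_add_pow_symbol a ε).comp_tendsto (tendsto_eigenvalue_cofinite hL))
  refine ⟨C, fun m => (le_abs_self _).trans ?_⟩
  simpa [abs_of_pos (hpos m)] using hC m

theorem exists_abs_div_symbol_le (hL : ∀ i, 0 < L i)
    (hpos : ∀ m, 0 < symbol a ε (eigenvalue L m)) {p : ℝ → ℝ}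
    (hp : ∀ l, 0 ≤ l → |p l| ≤ (1 + l) ^ 3) :
    ∃ C, ∀ m, |p (eigenvalue L m) / symbol a ε (eigenvalue L m)| ≤ C := by
  obtain ⟨C, hC⟩ := exists_one_add_eigenvalue_pow_le_mul_symbol hL hpos
  refine ⟨C, fun m => ?_⟩
  rw [abs_div, abs_of_pos (hpos m), div_le_iff₀ (hpos m)]
  exact (hp _ (eigenvalue_nonneg L m)).trans (hC m)

theorem summable_div_symbol (hL : ∀ i, 0 < L i)
    (hpos : ∀ m, 0 < symbol a ε (eigenvalue L m)) {p : ℝ → ℝ} (hp : ∀ l, 0 ≤ l → |p l| ≤ 1 + l) :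
    Summable fun m => p (eigenvalue L m) / symbol a ε (eigenvalue L m) := by
  obtain ⟨C, hC⟩ := exists_one_add_eigenvalue_pow_le_mul_symbol hL hpos
  refine .of_norm_bounded ((summable_inv_one_add_eigenvalue_sq hL).mul_left C) fun m => ?_
  have hl := eigenvalue_nonneg L m
  rw [Real.norm_eq_abs, abs_div, abs_of_pos (hpos m), ← div_eq_mul_inv,
    div_le_div_iff₀ (hpos m) (by positivity)]
  calc |p (eigenvalue L m)| * (1 + eigenvalue L m) ^ 2
      ≤ (1 + eigenvalue L m) * (1 + eigenvalue L m) ^ 2 := by gcongr; exact hp _ hl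
    _ = (1 + eigenvalue L m) ^ 3 := by ring
    _ ≤ _ := hC m

end Symbol

section BackwardDifference

variable {k : ℕ} {τ : ℝ}

theorem mul_le_bdfKernel_div {ε : ℝ} (hε : 0 < ε) (hτ0 : 0 < τ)
    (hτ : τ ≤ 2 / (3 * ε) * bdfKernel k 0) : 3 / 2 * ε ≤ bdfKernel k 0 / τ := by
  rw [le_div_iff₀ hτ0]
  calc 3 / 2 * ε * τ ≤ 3 / 2 * ε * (2 / (3 * ε) * bdfKernel k 0) := by gcongr
    _ = bdfKernel k 0 := by field_simp

theorem bdf_congr {V : Type*} [AddCommGroup V] [Module ℝ V] {φ χ : ℕ → V} {n : ℕ}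
    (h : ∀ j ≤ n, φ j = χ j) : bdf k τ φ n = bdf k τ χ n := by
  rw [bdf, bdf]
  congr 1
  refine Finset.sum_congr rfl fun j hj => ?_
  have hjn := (Finset.mem_Icc.1 hj).2
  rw [h j hjn, h (j - 1) ((Nat.sub_le _ _).trans hjn)]

theorem bdf_update {V : Type*} [AddCommGroup V] [Module ℝ V] (φ : ℕ → V) {n : ℕ} (hn : 1 ≤ n)
    (z : V) : bdf k τ (Function.update φ n z) n =
      (bdfKernel k 0 / τ) • z + bdf k τ (Function.update φ n 0) n := by
  obtain ⟨m, rfl⟩ := Nat.exists_eq_add_of_le' hn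
  have hhistory (u : V) : ∑ j ∈ Finset.Icc 1 m, bdfKernel k (m + 1 - j) •
      (Function.update φ (m + 1) u j - Function.update φ (m + 1) u (j - 1)) =
      ∑ j ∈ Finset.Icc 1 m, bdfKernel k (m + 1 - j) • (φ j - φ (j - 1)) := by
    refine Finset.sum_congr rfl fun j hj => ?_
    have hjm := (Finset.mem_Icc.1 hj).2
    rw [Function.update_of_ne (by lia), Function.update_of_ne (by lia)]
  simp only [bdf]
  rw [Finset.sum_Icc_succ_top (by lia), Finset.sum_Icc_succ_top (by lia), hhistory, hhistory]
  simp only [Function.update_self, Nat.sub_self, Nat.add_sub_cancel,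
    Function.update_of_ne m.succ_ne_self.symm]
  module

end BackwardDifference

section TimeStep

variable {L : Fin 2 → ℝ} {ε τ : ℝ} {k : ℕ}

theorem SolvesWeaklyAt.inner_bdf (hL : ∀ i, 0 < L i) {φ : ℕ → L2 L} {n : ℕ}
    (h : SolvesWeaklyAt L ε k τ φ n) (m : Fin 2 → ℤ) :
    inner ℝ (modeBasis hL m) (bdf k τ φ n) = -eigenvalue L m *
      ((1 - eigenvalue L m) ^ 2 * inner ℝ (modeBasis hL m) (φ n) +
        (∫ x in cell L, φ n x ^ 3 * mode L m x) - ε * inner ℝ (modeBasis hL m) (φ n)) := by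
  set l := eigenvalue L m
  have hlaplacian (r : ℝ) : Δ (fun x => r * mode L m x) = fun x => (-l * r) * mode L m x := by
    ext x
    rw [show (fun x => r * mode L m x) = r • mode L m from rfl, InnerProductSpace.laplacian_smul r
      (contDiff_infty.1 (isTest_mode hL m).smooth 2).contDiffAt, laplacian_mode]
    simp only [smul_eq_mul]
    ring
  have hlinear_int : IntegrableOn (fun x => φ n x * mode L m x) (cell L) :=
    (Lp.memLp (φ n)).integrable_mul (memLp_mode L m)
  have hcube_int : IntegrableOn (fun x => φ n x ^ 3 * mode L m x) (cell L) :=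
    h.1.mul_bdd (isTest_mode hL m).smooth.continuous.aestronglyMeasurable
      (.of_forall (abs_mode_le L m))
  have hlinear (x : Plane) : φ n x * (-l * mode L m x + 2 * (-l * -l * mode L m x) +
      -l * (-l * -l) * mode L m x) = -l * (1 - l) ^ 2 * (φ n x * mode L m x) := by ring
  have hcube (x : Plane) : (φ n x ^ 3 - ε * φ n x) * (-l * mode L m x) =
      -l * (φ n x ^ 3 * mode L m x - ε * (φ n x * mode L m x)) := by ring
  rw [inner_modeBasis, inner_modeBasis, h.2 (mode L m) (isTest_mode hL m), laplacian_mode,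
    hlaplacian, hlaplacian]
  simp only [hlinear, hcube, l]
  rw [integral_const_mul, integral_const_mul, integral_sub hcube_int (hlinear_int.const_mul ε),
    integral_const_mul]
  ring

variable {a : ℝ} {q z₀ z : L2 L}

theorem SolvesWeaklyAt.isHammersteinSolution (hL : ∀ i, 0 < L i)
    (hsymbol : ∀ m, symbol a ε (eigenvalue L m) ≠ 0) {φ : ℕ → L2 L} {n : ℕ}
    (h : SolvesWeaklyAt L ε k τ φ n) (hbdf : bdf k τ φ n = a • φ n + q)
    (hz₀ : ∀ m, inner ℝ (modeBasis hL m) z₀ =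
      -(symbol a ε (eigenvalue L m))⁻¹ * inner ℝ (modeBasis hL m) q) :
    IsHammersteinSolution (modeBasis hL)
      (fun m => eigenvalue L m / symbol a ε (eigenvalue L m)) (· ^ 3) z₀ (φ n) where
  integrable := h.1
  inner_eq m := by
    have hmode := h.inner_bdf hL m
    rw [hbdf, inner_add_right, real_inner_smul_right] at hmode
    rw [hz₀, integral_mul_modeBasis]
    exact (mode_equation_iff (hsymbol m) _ _ _).1 hmode

theorem exists_inner_modeBasis_eq_pow_mul (hL : ∀ i, 0 < L i)
    (hpos : ∀ m, 0 < symbol a ε (eigenvalue L m)) {c : L2 L}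
    (hz : ∀ m, inner ℝ (modeBasis hL m) z =
      -(symbol a ε (eigenvalue L m))⁻¹ * inner ℝ (modeBasis hL m) q -
        eigenvalue L m / symbol a ε (eigenvalue L m) * inner ℝ (modeBasis hL m) c)
    {j : ℕ} (hj : j ≤ 2) :
    ∃ v : L2 L, ∀ m, inner ℝ (modeBasis hL m) v =
      (1 - eigenvalue L m) ^ j * inner ℝ (modeBasis hL m) z := by
  have hfactor {l : ℝ} (hl : 0 ≤ l) : |(1 - l) ^ j| ≤ (1 + l) ^ 2 := by
    rw [abs_pow]
    exact (pow_le_pow_left₀ (abs_nonneg _) (abs_le.2 ⟨by linarith, by linarith⟩) j).trans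
      (pow_le_pow_right₀ (by linarith) hj)
  obtain ⟨C, hC⟩ := exists_abs_div_symbol_le hL hpos (p := fun l => (1 - l) ^ j) fun l hl =>
    (hfactor hl).trans (pow_le_pow_right₀ (by linarith) (by norm_num))
  obtain ⟨D, hD⟩ := exists_abs_div_symbol_le hL hpos (p := fun l => (1 - l) ^ j * l)
    fun l hl => by
      rw [abs_mul, abs_of_nonneg hl, pow_succ (1 + l) 2]
      exact mul_le_mul (hfactor hl) (by linarith) hl (by positivity)
  obtain ⟨v, hv⟩ := exists_forall_inner_basis_eq_mul (modeBasis hL) hC q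
  obtain ⟨w, hw⟩ := exists_forall_inner_basis_eq_mul (modeBasis hL) hD c
  refine ⟨-v - w, fun m => ?_⟩
  rw [inner_sub_right, inner_neg_right, hv, hw, hz]
  ring

theorem IsHammersteinSolution.exists_isChemicalPotential (hL : ∀ i, 0 < L i)
    (hpos : ∀ m, 0 < symbol a ε (eigenvalue L m))
    (hz₀ : ∀ m, inner ℝ (modeBasis hL m) z₀ =
      -(symbol a ε (eigenvalue L m))⁻¹ * inner ℝ (modeBasis hL m) q)
    (hz : IsHammersteinSolution (modeBasis hL)
      (fun m => eigenvalue L m / symbol a ε (eigenvalue L m)) (· ^ 3) z₀ z)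
    (hcube : MemLp ((· ^ 3) ∘ z) 2 (volume.restrict (cell L))) :
    ∃ μ, IsChemicalPotential L ε z μ ∧ IsLaplacian L μ (a • z + q) := by
  have hcoeff (m : Fin 2 → ℤ) : inner ℝ (modeBasis hL m) z =
      -(symbol a ε (eigenvalue L m))⁻¹ * inner ℝ (modeBasis hL m) q -
        eigenvalue L m / symbol a ε (eigenvalue L m) *
          inner ℝ (modeBasis hL m) (hcube.toLp _) := by
    rw [inner_toLp_eq_integral, hz.inner_eq, hz₀]
    rfl
  obtain ⟨v, hv⟩ := exists_inner_modeBasis_eq_pow_mul hL hpos hcoeff one_le_two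
  obtain ⟨w, hw⟩ := exists_inner_modeBasis_eq_pow_mul hL hpos hcoeff le_rfl
  refine ⟨w + hcube.toLp _ - ε • z, ⟨v, w, hcube.toLp _, ?_, ?_, hcube.coeFn_toLp, rfl⟩, ?_⟩
  · refine isLaplacian_of_inner hL fun m => ?_
    rw [inner_sub_right, hv]
    ring
  · refine isLaplacian_of_inner hL fun m => ?_
    rw [inner_sub_right, hv, hw]
    ring
  · refine isLaplacian_of_inner hL fun m => ?_
    rw [inner_add_right, real_inner_smul_right, inner_sub_right, inner_add_right,
      real_inner_smul_right, hw]
    exact (mode_equation_iff (hpos m).ne' _ _ _).2 (hcoeff m)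

theorem exists_inner_modeBasis_eq_neg_inv_symbol_mul (hL : ∀ i, 0 < L i)
    (hpos : ∀ m, 0 < symbol a ε (eigenvalue L m)) (q : L2 L) :
    ∃ z₀ : L2 L, (∀ m, inner ℝ (modeBasis hL m) z₀ =
      -(symbol a ε (eigenvalue L m))⁻¹ * inner ℝ (modeBasis hL m) q) ∧
      Summable fun m => |inner ℝ (modeBasis hL m) z₀| := by
  obtain ⟨C, hC⟩ := exists_abs_div_symbol_le hL hpos (p := -1) fun l hl => by
    simpa using one_le_pow₀ (by linarith : 1 ≤ 1 + l)
  obtain ⟨z₀, hmul⟩ := exists_forall_inner_basis_eq_mul (modeBasis hL) hC q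
  have hz₀ (m : Fin 2 → ℤ) : inner ℝ (modeBasis hL m) z₀ =
      -(symbol a ε (eigenvalue L m))⁻¹ * inner ℝ (modeBasis hL m) q := by
    rw [hmul, Pi.neg_apply, Pi.one_apply, neg_div, one_div]
  have hinv := summable_div_symbol hL hpos (p := 1) fun l hl => by simpa using hl
  refine ⟨z₀, hz₀, .of_nonneg_of_le (fun _ => abs_nonneg _) (fun m => ?_)
    (hinv.mul_right ‖q‖)⟩
  rw [hz₀, abs_mul, abs_neg, abs_inv, abs_of_pos (hpos m), Pi.one_apply, one_div]
  gcongr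
  · exact (inv_pos.2 (hpos m)).le
  · exact (abs_real_inner_le_norm _ _).trans_eq (by rw [(modeBasis hL).orthonormal.1 m, one_mul])

theorem exists_solvesAt_and_forall_solvesWeaklyAt_eq (hL : ∀ i, 0 < L i)
    (hpos : ∀ m, 0 < symbol (bdfKernel k 0 / τ) ε (eigenvalue L m)) {n : ℕ} (hn : 1 ≤ n)
    (φ : ℕ → L2 L) :
    ∃ z : L2 L, SolvesAt L ε k τ (Function.update φ n z) n ∧
      ∀ z' : L2 L, SolvesWeaklyAt L ε k τ (Function.update φ n z') n → z' = z := by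
  have hs0 (m : Fin 2 → ℤ) :
      0 ≤ eigenvalue L m / symbol (bdfKernel k 0 / τ) ε (eigenvalue L m) :=
    div_nonneg (eigenvalue_nonneg L m) (hpos m).le
  have hs := summable_div_symbol hL hpos (p := id) fun l hl => by
    rw [id, abs_of_nonneg hl]
    linarith
  have hcubic : Monotone fun t : ℝ => t ^ 3 := (Odd.strictMono_pow (by decide)).monotone
  have hlipschitz : LocallyLipschitz fun t : ℝ => t ^ 3 :=
    ContDiff.locallyLipschitz (𝕂 := ℝ) (by fun_prop)
  obtain ⟨z₀, hz₀, hz₀_summable⟩ := exists_inner_modeBasis_eq_neg_inv_symbol_mul hL hpos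
    (bdf k τ (Function.update φ n 0) n)
  obtain ⟨z, hz, hcube⟩ := exists_isHammersteinSolution (ae_abs_modeBasis_le hL)
    (Real.sqrt_nonneg _) hs0 hs hcubic hlipschitz (by simp) hz₀_summable
  obtain ⟨μ, hμ⟩ := hz.exists_isChemicalPotential hL hpos hz₀ hcube
  refine ⟨z, ⟨μ, ?_⟩, fun z' hz' => ?_⟩
  · rwa [bdf_update φ hn, Function.update_self]
  · have hz'_sol := hz'.isHammersteinSolution hL (fun m => (hpos m).ne')
      (by rw [bdf_update φ hn, Function.update_self]) hz₀
    rw [Function.update_self] at hz'_sol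
    exact hz'_sol.eq hz (ae_abs_modeBasis_le hL) hs0 hs hcubic (continuous_pow 3) hz₀_summable

end TimeStep

section TimeMarching

/-- A property of a sequence at a time which only depends on the values up to that time. -/
def IsCausal {V : Type*} (P : (ℕ → V) → ℕ → Prop) : Prop :=
  ∀ ⦃φ χ : ℕ → V⦄ ⦃n : ℕ⦄, (∀ j ≤ n, φ j = χ j) → P φ n → P χ n

variable {V : Type*} {P W : (ℕ → V) → ℕ → Prop}

theorem IsCausal.exists_forall [Nonempty V] (hP : IsCausal P)
    (hstep : ∀ n φ, ∃ z, P (Function.update φ n z) n) : ∃ φ, ∀ n, P φ n := by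
  choose next hnext using hstep
  let Φ : ℕ → ℕ → V := Nat.rec (fun _ => Classical.arbitrary V) fun n χ =>
    Function.update χ n (next n χ)
  have hstable {j n : ℕ} (hjn : j + 1 ≤ n) : Φ n j = Φ (j + 1) j := by
    induction n, hjn using Nat.le_induction with
    | base => rfl
    | succ n hjn ih => exact (Function.update_of_ne (by lia) _ _).trans ih
  exact ⟨fun j => Φ (j + 1) j, fun n =>
    hP (φ := Φ (n + 1)) (fun j hj => hstable (Nat.succ_le_succ hj)) (hnext n (Φ n))⟩

theorem IsCausal.eq_of_forall (hP : IsCausal P) {φ φ' : ℕ → V} {k N : ℕ}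
    (hstart : ∀ n < k, φ' n = φ n)
    (hφ : ∀ n, k ≤ n → n ≤ N → ∀ z, P (Function.update φ n z) n → z = φ n)
    (hφ' : ∀ n, k ≤ n → n ≤ N → P φ' n) : ∀ n ≤ N, φ' n = φ n := by
  intro n
  induction n using Nat.strong_induction_on with
  | _ n ih =>
    intro hn
    rcases lt_or_ge n k with hnk | hkn
    · exact hstart n hnk
    refine hφ n hkn hn _ (hP (fun j hj => ?_) (hφ' n hkn hn))
    rcases hj.eq_or_lt with rfl | hlt
    · rw [Function.update_self]
    · rw [Function.update_of_ne hlt.ne, ih j hlt (hlt.le.trans hn)]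

theorem IsCausal.forall_update_eq (hP : IsCausal P) :
    IsCausal fun φ n => ∀ z, P (Function.update φ n z) n → z = φ n := by
  intro φ χ n h huniq z hz
  rw [← h n le_rfl]
  refine huniq z (hP (fun j hj => ?_) hz)
  simp only [Function.update_apply, h j hj]

theorem IsCausal.exists_forall_and_forall_eq (hP : IsCausal P) (hW : IsCausal W) {k : ℕ}
    (hstep : ∀ n, k ≤ n → ∀ φ, ∃ z, P (Function.update φ n z) n ∧
      ∀ z', W (Function.update φ n z') n → z' = z) (φ₀ : ℕ → V) :
    ∃ φ, (∀ n < k, φ n = φ₀ n) ∧ (∀ n, k ≤ n → P φ n) ∧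
      ∀ N φ', (∀ n < k, φ' n = φ₀ n) → (∀ n, k ≤ n → n ≤ N → W φ' n) →
        ∀ n ≤ N, φ' n = φ n := by
  have hcausal : IsCausal fun φ n => (n < k → φ n = φ₀ n) ∧
      (k ≤ n → P φ n ∧ ∀ z, W (Function.update φ n z) n → z = φ n) := fun φ χ n h hφ =>
    ⟨fun hn => h n le_rfl ▸ hφ.1 hn,
      fun hn => ⟨hP h (hφ.2 hn).1, hW.forall_update_eq h (hφ.2 hn).2⟩⟩
  have : Nonempty V := ⟨φ₀ 0⟩
  obtain ⟨φ, hφ⟩ := hcausal.exists_forall fun n φ => by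
    rcases lt_or_ge n k with hn | hn
    · exact ⟨φ₀ n, fun _ => Function.update_self .., fun h => absurd h hn.not_ge⟩
    · obtain ⟨z, hz, huniq⟩ := hstep n hn φ
      refine ⟨z, fun h => absurd h hn.not_gt, fun _ => ⟨hz, fun z' hz' => ?_⟩⟩
      rw [Function.update_idem] at hz'
      rw [Function.update_self, huniq z' hz']
  exact ⟨φ, fun n => (hφ n).1, fun n hn => ((hφ n).2 hn).1, fun N φ' hstart hφ' =>
    hW.eq_of_forall (fun n hn => (hstart n hn).trans ((hφ n).1 hn).symm)
      (fun n hn _ => ((hφ n).2 hn).2) hφ'⟩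

theorem isCausal_solvesAt (L : Fin 2 → ℝ) (ε : ℝ) (k : ℕ) (τ : ℝ) :
    IsCausal (SolvesAt L ε k τ) := by
  intro φ χ n h hφ
  rwa [SolvesAt, h n le_rfl, bdf_congr h] at hφ

theorem isCausal_solvesWeaklyAt (L : Fin 2 → ℝ) (ε : ℝ) (k : ℕ) (τ : ℝ) :
    IsCausal (SolvesWeaklyAt L ε k τ) := by
  intro φ χ n h hφ
  rwa [SolvesWeaklyAt, h n le_rfl, bdf_congr h] at hφ

end TimeMarching

end PFC

theorem mainTheorem4_general {L : Fin 2 → ℝ} (hL : ∀ i, 0 < L i) {ε τ : ℝ} {k : ℕ}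
    (hpos : ∀ m, 0 < PFC.symbol (PFC.bdfKernel k 0 / τ) ε (PFC.eigenvalue L m)) :
    (∀ n : ℕ, k ≤ n → ∀ φ : ℕ → PFC.L2 L,
      ∃ z : PFC.L2 L, PFC.SolvesAt L ε k τ (Function.update φ n z) n ∧
        ∀ z' : PFC.L2 L, PFC.SolvesWeaklyAt L ε k τ (Function.update φ n z') n → z' = z) ∧
    (∀ φ₀ : ℕ → PFC.L2 L,
      ∃ φ : ℕ → PFC.L2 L, (∀ n, n < k → φ n = φ₀ n) ∧
        (∀ n, k ≤ n → PFC.SolvesAt L ε k τ φ n) ∧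
        ∀ (N : ℕ) (φ' : ℕ → PFC.L2 L), (∀ n, n < k → φ' n = φ₀ n) →
          (∀ n, k ≤ n → n ≤ N → PFC.SolvesWeaklyAt L ε k τ φ' n) →
          ∀ n, n ≤ N → φ' n = φ n) := by
  have hk : k ≠ 0 := by
    rintro rfl
    simpa [PFC.symbol, PFC.bdfKernel, PFC.eigenvalue] using hpos 0
  have hlevel (n : ℕ) (hn : k ≤ n) (φ : ℕ → PFC.L2 L) :=
    PFC.exists_solvesAt_and_forall_solvesWeaklyAt_eq hL hpos
      ((Nat.one_le_iff_ne_zero.2 hk).trans hn) φ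
  exact ⟨hlevel, (PFC.isCausal_solvesAt L ε k τ).exists_forall_and_forall_eq
    (PFC.isCausal_solvesWeaklyAt L ε k τ) hlevel⟩

theorem mainTheorem4
    (L : Fin 2 → ℝ) (hL : ∀ i, 0 < L i)
    (ε : ℝ) (hε0 : 0 < ε) (hε1 : ε < 1)
    (k : ℕ) (hk3 : 3 ≤ k) (hk6 : k ≤ 6)
    (τ : ℝ) (hτ0 : 0 < τ) (hτ : τ ≤ 2 / (3 * ε) * PFC.bdfKernel k 0)
    (N : ℕ) :
    -- each time level: the previous values, whatever they are, determine the next one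
    (∀ n : ℕ, k ≤ n → n ≤ N → ∀ φ : ℕ → PFC.L2 L,
      ∃ z : PFC.L2 L, PFC.SolvesAt L ε k τ (Function.update φ n z) n ∧
        ∀ z' : PFC.L2 L, PFC.SolvesWeaklyAt L ε k τ (Function.update φ n z') n → z' = z) ∧
    -- the whole scheme: the starting values determine the solution
    (∀ φ₀ : ℕ → PFC.L2 L,
      ∃ φ : ℕ → PFC.L2 L, (∀ n, n < k → φ n = φ₀ n) ∧
        (∀ n, k ≤ n → n ≤ N → PFC.SolvesAt L ε k τ φ n) ∧
        ∀ φ' : ℕ → PFC.L2 L, (∀ n, n < k → φ' n = φ₀ n) →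
          (∀ n, k ≤ n → n ≤ N → PFC.SolvesWeaklyAt L ε k τ φ' n) →
          ∀ n, n ≤ N → φ' n = φ n) := by
  have hpos (m : Fin 2 → ℤ) := PFC.symbol_pos hε0 hε1
    (PFC.mul_le_bdfKernel_div hε0 hτ0 hτ) (PFC.eigenvalue_nonneg L m)
  have ⟨hlevel, hscheme⟩ := mainTheorem4_general hL hpos
  exact ⟨fun n hn _ => hlevel n hn, fun φ₀ => (hscheme φ₀).imp fun φ hφ =>
    ⟨hφ.1, fun n hn _ => hφ.2.1 n hn, hφ.2.2 N⟩⟩
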